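/- Let $d\ge 1$, let $A$ be a real symmetric positive definite $d\times d$ matrix, and let $Q(x)=Q_A(x)=x^TAx$ be the associated quadratic form on $\mathbb R^d$. For a square matrix $M$ write $Q_M(x)=x^TMx$. For integers $N\ge 0$ and $s\in\mathbb C$ with $\operatorname{Re}s<d/2$ put $$\sigma_N(s)=\sum_{\substack{n\in\mathbb Z^d,\ n\ne 0\\ \|n\|_\infty\le N}}\frac1{Q(n)^s}-\int_{[-N-1/2,\,N+1/2]^d}\frac{dx}{Q(x)^s},$$ where the integral converges absolutely, and let $\sigma(s)=\lim_{N\to\infty}\sigma_N(s)$ whenever this limit exists. Let $\alpha(s)$ be the Epstein zeta function $\sum_{n\in\mathbb Z^d,\,n\neq0}Q(n)^{-s}$ $(\operatorname{Re}s>d/2)$, a series that converges absolutely and has an analytic continuation, also denoted $\alpha$, to $\mathbb C\setminus\{d/2\}$. Finally let $B(s)=\operatorname{tr}(A)\,A-2(s+1)A^2$ and $$V_Q(s)=\int_{\|x\|_\infty=1}\frac{Q_{B(s)}(x)}{Q_A(x)^{s+2}}\,d\lambda_{d-1},$$ where $\lambda_{d-1}$ is the induced $(d-1)$-dimensional surface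 measure on the boundary of the cube $[-1,1]^d$, that is, $dx_1\cdots dx_{j-1}\,dx_{j+1}\cdots dx_d$ on the faces $x_j=\pm1$ (counting measure on the two points $\pm1$ if $d=1$). Then the limit $\sigma(s)$ exists for every $s$ in the strip $d/2-1<\operatorname{Re}s<d/2$ and also for $s=d/2-1$. In the strip, $\sigma(s)=\alpha(s)$. Moreover, $V_Q$ is complex differentiable at $d/2-1$, and $$\sigma(d/2-1)+\frac{d/2-1}{24}\,V_Q'(d/2-1)=\alpha(d/2-1)=\lim_{\varepsilon\to0^+}\sigma(d/2-1+\varepsilon).$$ -/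

import Mathlib

open Filter Topology MeasureTheory

noncomputable section

namespace WignerLimit

/-- The quadratic form `Q_M(x) = xᵀ M x = ∑ i, j, M i j * x i * x j`, over a commutative ring. -/
def quadForm {R : Type*} [CommRing R] {d : ℕ} (M : Matrix (Fin d) (Fin d) R)
    (x : Fin d → R) : R :=
  dotProduct x (M.mulVec x)

/-- The value of `Q_A` at an integer vector. -/
def quadFormInt {d : ℕ} (A : Matrix (Fin d) (Fin d) ℝ) (n : Fin d → ℤ) : ℝ :=
  quadForm A (fun i => (n i : ℝ))

/-- `α_N(s)`: the sum of `Q(n)^{-s}` over the nonzero `n ∈ {-N, …, N}^d`. -/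
def alphaN {d : ℕ} (A : Matrix (Fin d) (Fin d) ℝ) (N : ℕ) (s : ℂ) : ℂ :=
  ∑ n ∈ (Finset.Icc (fun _ : Fin d => -(N : ℤ)) (fun _ => (N : ℤ))).erase 0,
    1 / ((quadFormInt A n : ℝ) : ℂ) ^ s

/-- The cube `[-N - 1/2, N + 1/2]^d`. -/
def cube (d : ℕ) (N : ℕ) : Set (Fin d → ℝ) :=
  Set.Icc (fun _ => -(N : ℝ) - 1 / 2) (fun _ => (N : ℝ) + 1 / 2)

/-- `β_N(s)`: the Lebesgue integral of `Q(x)^{-s}` over `[-N - 1/2, N + 1/2]^d`. -/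
def betaN {d : ℕ} (A : Matrix (Fin d) (Fin d) ℝ) (N : ℕ) (s : ℂ) : ℂ :=
  ∫ x in cube d N, 1 / ((quadForm A x : ℝ) : ℂ) ^ s

/-- `σ_N(s) = α_N(s) - β_N(s)`. -/
def sigmaN {d : ℕ} (A : Matrix (Fin d) (Fin d) ℝ) (N : ℕ) (s : ℂ) : ℂ :=
  alphaN A N s - betaN A N s

/-- `Z` is the analytic continuation to `ℂ ∖ {d/2}` of the Epstein zeta function
`∑_{n ∈ ℤ^d, n ≠ 0} Q_A(n)^{-s}`, `Re s > d/2`. Since `ℂ ∖ {d/2}` is connected, this determines `Z`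
at every point other than `d/2`. -/
structure IsEpsteinZeta {d : ℕ} (A : Matrix (Fin d) (Fin d) ℝ) (Z : ℂ → ℂ) : Prop where
  hasSum : ∀ s : ℂ, (d : ℝ) / 2 < s.re →
    HasSum (fun n : {n : Fin d → ℤ // n ≠ 0} => 1 / ((quadFormInt A n.1 : ℝ) : ℂ) ^ s) (Z s)
  differentiableOn : DifferentiableOn ℂ Z {(d : ℂ) / 2}ᶜ

/-- The point `x` with `x j = c` whose other coordinates are those of `y`. -/
def facePoint {d : ℕ} (j : Fin d) (c : ℝ) (y : {i : Fin d // i ≠ j} → ℝ) : Fin d → ℝ :=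
  fun i => if h : i = j then c else y ⟨i, h⟩

/-- The integral over the boundary `‖x‖_∞ = 1` of the cube `[-1, 1]^d` for the induced
`(d-1)`-dimensional measure, which is `dx_1 ⋯ dx_{j-1} dx_{j+1} ⋯ dx_d` on the two faces
`x_j = 1` and `x_j = -1`. -/
def cubeBoundaryIntegral {d : ℕ} (F : (Fin d → ℝ) → ℂ) : ℂ :=
  ∑ j : Fin d,
    ((∫ y in Set.Icc (fun _ : {i : Fin d // i ≠ j} => (-1 : ℝ)) (fun _ => 1),
        F (facePoint j 1 y)) +
      ∫ y in Set.Icc (fun _ : {i : Fin d // i ≠ j} => (-1 : ℝ)) (fun _ => 1),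
        F (facePoint j (-1) y))

/-- `B(s) = tr(A) A - 2 (s + 1) A²`. -/
def matB {d : ℕ} (A : Matrix (Fin d) (Fin d) ℝ) (s : ℂ) : Matrix (Fin d) (Fin d) ℂ :=
  ((A.trace : ℝ) : ℂ) • A.map Complex.ofReal - (2 * (s + 1)) • (A ^ 2).map Complex.ofReal

/-- `V_Q(s)`: the integral of `Q_{B(s)} / Q_A^{s+2}` over `‖x‖_∞ = 1`. -/
def V {d : ℕ} (A : Matrix (Fin d) (Fin d) ℝ) (s : ℂ) : ℂ :=
  cubeBoundaryIntegral fun x : Fin d → ℝ =>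
    quadForm (matB A s) (fun i => (x i : ℂ)) / ((quadForm A x : ℝ) : ℂ) ^ (s + 2)

end WignerLimit

end

noncomputable section

namespace WignerLimit

section

open Asymptotics HurwitzZeta

/-! ### Gaussian sums over lattices -/

/-! Cut the cube `[-N - 1/2, N + 1/2]^d` into unit cells centred at integer points. Then `σ_N(s)` is
the sum over `n ≠ 0` of the defects `Q(n)^{-s} - ∫_{cell n} Q^{-s}`, minus the integral over the
central cell. By homogeneity that central integral equals `(1/2)^{d-2s} / (d-2s)` times an entire
function of `s`, which continues it to all `s ≠ d/2`.

Linear terms cancel over a cell by symmetry, so the defect is `O(‖n‖^{-2 Re s - 2})`, and the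
defects sum to a holomorphic function on `Re s > d/2 - 1`. For `Re s > d/2` this function is `α(s)`
plus the central term, because the boundary term `(N + 1/2)^{d-2s}` tends to `0`. The identity
theorem carries the equality into the strip (`tsum_cellDefect_of_strip`), which gives `σ = α` there.

At `s₀ = d/2 - 1` one more order is needed. The second order part of the defect is `-1/24` times the
Laplacian of `Q^{-s}`, that is `s/12` times `qLap`. When it is replaced by its cell average, the
remainder is `O(‖n‖^{-2 Re s - 3})` and hence summable near `s₀`, while the averages add up to an
integral over a cubical shell, namely `V(s)` times `∫ r^{d-3-2s} dr`. For `Re s > d/2 - 1` their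
total contribution is `(1/2)^{d-2-2s} / 24 · s V(s) / (s - s₀)`; at `s₀` itself it is `s₀ V(s₀)`
times a logarithm.

Since `α`, the central term and the remainder sum are all continuous at `s₀`, the quotient must stay
bounded. This forces `s₀ V(s₀) = 0` without any use of the divergence theorem, so `σ_N(s₀)`
converges, and the limit of the quotient is the derivative `V(s₀) + s₀ V'(s₀)` of `s V(s)`
(`critical_identity`). If `s₀ ≠ 0`, then `V(s₀) = 0` and the correction is `s₀ V'(s₀) / 24`. If `s₀
= 0`, then `σ_N(0) = -1 = α(0)` by direct computation.

The continuation of `α` comes from the Mellin transform of the theta series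
(`exists_isEpsteinZeta`). Only the behaviour of the theta series at `0` is needed, with an error of
rapid decay; it follows from one-dimensional Poisson summation by induction on `d`
(`exists_gaussian_sum_approx`). -/

/-- After Poisson summation the shift `y` enters only through phases of modulus one, so the
nonconstant terms are dominated by those for `y = 0`. The uniformity in `y` is what the induction on
the dimension requires. -/
theorem abs_evenKernel_sub_le (y : ℝ) {t : ℝ} (ht : 0 < t) :
    |evenKernel y t - 1 / t ^ (1 / 2 : ℝ)| ≤
      1 / t ^ (1 / 2 : ℝ) * (cosKernel 0 (1 / t) - 1) := by
  have ht' : 0 < 1 / t := by positivity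
  rw [evenKernel_functional_equation, ← mul_sub_one, abs_mul, abs_of_pos (by positivity)]
  gcongr
  have h1 := hasSum_int_cosKernel₀ y ht'
  have h0 := hasSum_int_cosKernel₀ 0 ht'
  have h0' : HasSum (fun n : ℤ => if n = 0 then (0 : ℝ) else Real.exp (-Real.pi * n ^ 2 * (1 / t)))
      (cosKernel 0 (1 / t) - 1) := by
    rw [← Complex.hasSum_ofReal]
    convert! h0 using 1
    · ext n
      split_ifs <;> simp
    · push_cast; rfl
  have := h1.norm_le_of_bounded h0' (fun n => ?_)
  · rwa [← Complex.ofReal_one, ← Complex.ofReal_sub, Complex.norm_real, Real.norm_eq_abs] at this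
  · split_ifs
    · simp
    · rw [norm_mul, Complex.norm_real, Real.norm_of_nonneg (Real.exp_pos _).le]
      rw [show 2 * (Real.pi : ℂ) * Complex.I * y * n = ((2 * Real.pi * y * n : ℝ) : ℂ) * Complex.I by
        push_cast; ring, Complex.norm_exp_ofReal_mul_I, one_mul]

theorem cosKernel_one_div_sub_one_isBigO (r : ℝ) :
    (fun t : ℝ => cosKernel 0 (1 / t) - 1) =O[𝓝[>] 0] fun t => t ^ r := by
  obtain ⟨p, hp, h⟩ := isBigO_atTop_cosKernel_sub 0
  have h2 := (h.trans (isLittleO_exp_neg_mul_rpow_atTop hp (-r)).isBigO).comp_tendsto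
    tendsto_inv_nhdsGT_zero
  refine (h2.congr' ?_ ?_)
  · filter_upwards with t; simp
  · filter_upwards [self_mem_nhdsWithin] with t (ht : 0 < t)
    simp [Real.inv_rpow ht.le, Real.rpow_neg ht.le]

theorem one_le_cosKernel_zero {t : ℝ} (ht : 0 < t) : 0 ≤ cosKernel 0 (1 / t) - 1 := by
  have := (abs_nonneg _).trans (abs_evenKernel_sub_le 0 ht)
  have h : 0 < 1 / t ^ (1 / 2 : ℝ) := by positivity
  exact nonneg_of_mul_nonneg_right this h

/-- Completing the square in the first variable of a positive definite form. -/
theorem exists_complete_square {d : ℕ} (Q : QuadraticMap ℝ (Fin (d + 1) → ℝ) ℝ)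
    (hQ : Q.PosDef) :
    ∃ a : ℝ, 0 < a ∧ ∃ l : (Fin d → ℝ) →ₗ[ℝ] ℝ, ∃ Q' : QuadraticMap ℝ (Fin d → ℝ) ℝ,
      Q'.PosDef ∧ ∀ (x : ℝ) (y : Fin d → ℝ),
        Q (Fin.cons x y) = a * (x + l y) ^ 2 + Q' y := by
  let e : Fin (d + 1) → ℝ := Fin.cons 1 0
  let J : (Fin d → ℝ) →ₗ[ℝ] (Fin (d + 1) → ℝ) :=
    { toFun := fun y => Fin.cons 0 y
      map_add' := fun y z => by
        ext i; refine Fin.cases ?_ (fun i => ?_) i <;> simp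
      map_smul' := fun c y => by
        ext i; refine Fin.cases ?_ (fun i => ?_) i <;> simp }
  have he : e ≠ 0 := fun h => by simpa [e] using congrFun h 0
  -- `Q e` is the leading coefficient. The map `T` below subtracts from `(0, y)` its component along
  -- `e`, so that `T y` is orthogonal to `e` for the polar form.
  have ha : 0 < Q e := hQ e he
  let l : (Fin d → ℝ) →ₗ[ℝ] ℝ := (1 / (2 * Q e)) • ((Q.polarBilin e).comp J)
  let T : (Fin d → ℝ) →ₗ[ℝ] (Fin (d + 1) → ℝ) := J - l.smulRight e
  have hl : ∀ y, QuadraticMap.polar Q e (J y) = 2 * Q e * l y := fun y => by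
    simp only [l, LinearMap.smul_apply, LinearMap.comp_apply, QuadraticMap.polarBilin_apply_apply,
      smul_eq_mul]
    field_simp
  refine ⟨Q e, ha, l, Q.comp T, ?_, fun x y => ?_⟩
  · intro y hy
    refine hQ _ fun h => hy ?_
    ext i
    simpa [T, J, e] using congrFun h i.succ
  · have h1 : (Fin.cons x y : Fin (d + 1) → ℝ) = (x + l y) • e + T y := by
      ext i
      refine Fin.cases ?_ (fun i => ?_) i <;> simp [T, J, e]
    have h2 : QuadraticMap.polar Q ((x + l y) • e) (T y) = 0 := by
      rw [QuadraticMap.polar_smul_left]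
      simp only [T, LinearMap.sub_apply, LinearMap.smulRight_apply]
      rw [QuadraticMap.polar_sub_right, QuadraticMap.polar_smul_right, hl,
        QuadraticMap.polar_self]
      simp only [smul_eq_mul]; ring
    rw [h1, QuadraticMap.map_add Q, h2, QuadraticMap.map_smul, QuadraticMap.comp_apply]
    simp only [smul_eq_mul]; ring

/-- Up to a relative error of rapid decay, uniformly in the shift, a Gaussian sum over `ℤ^d`
equals the corresponding integral. -/
theorem exists_gaussian_sum_approx (d : ℕ) : ∀ Q : QuadraticMap ℝ (Fin d → ℝ) ℝ, Q.PosDef →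
    ∃ c : ℝ, 0 < c ∧ ∃ δ : ℝ → ℝ, (∀ r : ℝ, δ =O[𝓝[>] 0] fun t => t ^ r) ∧
      ∀ t : ℝ, 0 < t → ∀ x : Fin d → ℝ, ∃ S : ℝ,
        HasSum (fun n : Fin d → ℤ => Real.exp (-Real.pi * Q ((fun i => (n i : ℝ)) + x) * t)) S ∧
        |S - c * t ^ (-(d : ℝ) / 2)| ≤ t ^ (-(d : ℝ) / 2) * δ t := by
  induction d with
  | zero =>
    intro Q hQ
    refine ⟨1, one_pos, 0, fun r => isBigO_zero _ _, fun t ht x => ⟨1, ?_, by simp⟩⟩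
    have h0 : ∀ y : Fin 0 → ℝ, Q y = 0 := fun y => by
      rw [Subsingleton.elim y 0, QuadraticMap.map_zero]
    simp only [h0]
    simp
  | succ d ih =>
    intro Q hQ
    obtain ⟨a, ha, l, Q', hQ', hsq⟩ := exists_complete_square Q hQ
    obtain ⟨c, hc, δ, hδ, hS⟩ := ih Q' hQ'
    let δ₁ : ℝ → ℝ := fun t => cosKernel 0 (1 / (a * t)) - 1
    have hδ₁ : ∀ r : ℝ, δ₁ =O[𝓝[>] 0] fun t => t ^ r := fun r => by
      have htend : Tendsto (fun t : ℝ => a * t) (𝓝[>] 0) (𝓝[>] 0) := by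
        refine tendsto_nhdsWithin_iff.2 ⟨?_, ?_⟩
        · have : Tendsto (fun t : ℝ => a * t) (𝓝 0) (𝓝 (a * 0)) :=
            (continuous_const_mul a).tendsto 0
          rw [mul_zero] at this
          exact this.mono_left nhdsWithin_le_nhds
        · filter_upwards [self_mem_nhdsWithin] with t (ht : 0 < t)
          exact mul_pos ha ht
      refine ((cosKernel_one_div_sub_one_isBigO r).comp_tendsto htend).trans ?_
      refine IsBigO.of_bound (a ^ r) ?_
      filter_upwards [self_mem_nhdsWithin] with t (ht : 0 < t)
      simp only [Function.comp_apply]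
      rw [Real.mul_rpow ha.le ht.le, norm_mul, Real.norm_of_nonneg (Real.rpow_nonneg ha.le _)]
    -- Each sum over the first coordinate is `(a t)^{-1/2}` up to relative error `δ₁ t`, and the
    -- remaining sum is at most `t^{-d/2} (c + δ t)`. The two errors combine to `δ₁ (c + δ) + δ`.
    refine ⟨c * a ^ (-(1 / 2) : ℝ), by positivity,
      fun t => a ^ (-(1 / 2) : ℝ) * (δ₁ t * (c + δ t) + δ t), fun r => ?_, fun t ht x => ?_⟩
    · refine IsBigO.const_mul_left (IsBigO.add ?_ (hδ r)) _
      have h0 : (fun t => c + δ t) =O[𝓝[>] 0] fun _ => (1 : ℝ) := by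
        refine (isBigO_const_const c one_ne_zero _).add ?_
        simpa using hδ 0
      simpa using (hδ₁ r).mul h0
    · have hat : 0 < a * t := mul_pos ha ht
      obtain ⟨S, hS1, hS2⟩ := hS t ht (Fin.tail x)
      let K : (Fin d → ℤ) → ℝ := fun n =>
        evenKernel ((x 0 + l ((fun i => (n i : ℝ)) + Fin.tail x) : ℝ) : UnitAddCircle) (a * t)
      let E : (Fin d → ℤ) → ℝ := fun n =>
        Real.exp (-Real.pi * Q' ((fun i => (n i : ℝ)) + Fin.tail x) * t)
      have hterm : ∀ (m : ℤ) (n : Fin d → ℤ),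
          Real.exp (-Real.pi * Q ((fun i => ((Fin.cons m n : Fin (d + 1) → ℤ) i : ℝ)) + x) * t) =
          E n * Real.exp (-Real.pi * (m + (x 0 + l ((fun i => (n i : ℝ)) + Fin.tail x))) ^ 2
            * (a * t)) := fun m n => by
        have : ((fun i => ((Fin.cons m n : Fin (d + 1) → ℤ) i : ℝ)) + x) =
            Fin.cons (m + x 0) ((fun i => (n i : ℝ)) + Fin.tail x) := by
          ext i
          refine Fin.cases ?_ (fun i => ?_) i <;> simp [Fin.tail]
        rw [this, hsq, ← Real.exp_add]
        congr 1; ring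
      have hfib : ∀ n : Fin d → ℤ, HasSum (fun m : ℤ => E n *
          Real.exp (-Real.pi * (m + (x 0 + l ((fun i => (n i : ℝ)) + Fin.tail x))) ^ 2
            * (a * t))) (E n * K n) := fun n =>
        (hasSum_int_evenKernel _ hat).mul_left _
      have hK : ∀ n, |K n - 1 / (a * t) ^ (1 / 2 : ℝ)| ≤ 1 / (a * t) ^ (1 / 2 : ℝ) * δ₁ t :=
        fun n => abs_evenKernel_sub_le _ hat
      have hEpos : ∀ n, 0 ≤ E n := fun n => (Real.exp_pos _).le
      set A : ℝ := 1 / (a * t) ^ (1 / 2 : ℝ) with hA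
      have hA0 : 0 < A := by positivity
      have hD : HasSum (fun n => E n * (A * δ₁ t)) (S * (A * δ₁ t)) := hS1.mul_right _
      have hsumdiff : Summable fun n => E n * (K n - A) := by
        refine Summable.of_norm_bounded hD.summable fun n => ?_
        rw [norm_mul, Real.norm_of_nonneg (hEpos n)]
        exact mul_le_mul_of_nonneg_left (hK n) (hEpos n)
      have hsumK : HasSum (fun n => E n * K n) (S * A + ∑' n, E n * (K n - A)) := by
        have := (hS1.mul_right A).add hsumdiff.hasSum
        exact this.congr_fun fun n => by ring
      have hdiff : |∑' n, E n * (K n - A)| ≤ S * (A * δ₁ t) := by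
        rw [← Real.norm_eq_abs]
        refine tsum_of_norm_bounded hD fun n => ?_
        rw [norm_mul, Real.norm_of_nonneg (hEpos n)]
        exact mul_le_mul_of_nonneg_left (hK n) (hEpos n)
      let F : (Fin d → ℤ) × ℤ → ℝ := fun p => E p.1 *
          Real.exp (-Real.pi * (p.2 + (x 0 + l ((fun i => (p.1 i : ℝ)) + Fin.tail x))) ^ 2
            * (a * t))
      -- All terms are positive, so summing along the fibres decides summability on the product.
      have hFs : Summable F := by
        refine (summable_prod_of_nonneg fun p => mul_nonneg (hEpos _) (Real.exp_pos _).le).2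
          ⟨fun n => (hfib n).summable, ?_⟩
        refine hsumK.summable.congr fun n => ?_
        exact (hfib n).tsum_eq.symm
      have hF : HasSum F (S * A + ∑' n, E n * (K n - A)) := by
        have h1 := hFs.hasSum.prod_fiberwise hfib
        rw [hsumK.unique h1]
        exact hFs.hasSum
      refine ⟨S * A + ∑' n, E n * (K n - A), ?_, ?_⟩
      · let e : (Fin (d + 1) → ℤ) ≃ (Fin d → ℤ) × ℤ :=
          (Fin.consEquiv (fun _ => ℤ)).symm.trans (Equiv.prodComm _ _)
        refine (e.symm.hasSum_iff (f := _)).1 (hF.congr_fun fun p => ?_)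
        exact hterm p.2 p.1
      · have hAeq : A = a ^ (-(1 / 2) : ℝ) * t ^ (-(1 / 2) : ℝ) := by
          rw [hA, Real.mul_rpow ha.le ht.le, Real.rpow_neg ha.le, Real.rpow_neg ht.le]
          field_simp
        have hpow : t ^ (-((d + 1 : ℕ) : ℝ) / 2) = t ^ (-(1 / 2) : ℝ) * t ^ (-(d : ℝ) / 2) := by
          rw [← Real.rpow_add ht]; congr 1; push_cast; ring
        have hδ₁0 : 0 ≤ δ₁ t := one_le_cosKernel_zero hat
        have hSle : S ≤ t ^ (-(d : ℝ) / 2) * (c + δ t) := by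
          have := (abs_le.1 hS2).2
          linarith
        calc |S * A + ∑' n, E n * (K n - A) -
              c * a ^ (-(1 / 2) : ℝ) * t ^ (-((d + 1 : ℕ) : ℝ) / 2)|
            = |A * (S - c * t ^ (-(d : ℝ) / 2)) + ∑' n, E n * (K n - A)| := by
              rw [hpow, hAeq]; congr 1; ring
          _ ≤ A * (t ^ (-(d : ℝ) / 2) * δ t) + S * (A * δ₁ t) := by
              refine (abs_add_le _ _).trans (add_le_add ?_ hdiff)
              rw [abs_mul, abs_of_pos hA0]
              gcongr
          _ ≤ A * (t ^ (-(d : ℝ) / 2) * δ t) + (t ^ (-(d : ℝ) / 2) * (c + δ t)) * (A * δ₁ t) := by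
              gcongr
          _ = _ := by rw [hpow, hAeq]; ring

end

variable {d : ℕ} {A : Matrix (Fin d) (Fin d) ℝ}

section

open Asymptotics

/-! ### Quadratic forms and integer vectors -/

theorem quadForm_smul {R : Type*} [CommRing R] (M : Matrix (Fin d) (Fin d) R) (c : R)
    (x : Fin d → R) : quadForm M (c • x) = c ^ 2 * quadForm M x := by
  simp only [quadForm, Matrix.mulVec_smul, dotProduct_smul, smul_dotProduct, smul_eq_mul]
  ring

theorem quadForm_eq_sum {R : Type*} [CommRing R] (M : Matrix (Fin d) (Fin d) R)
    (x : Fin d → R) : quadForm M x = ∑ i, ∑ j, M i j * (x i * x j) := by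
  simp only [quadForm, dotProduct, Matrix.mulVec, Finset.mul_sum]
  refine Finset.sum_congr rfl fun i _ => Finset.sum_congr rfl fun j _ => ?_
  ring

theorem quadForm_zero (M : Matrix (Fin d) (Fin d) ℝ) : quadForm M 0 = 0 := by
  simp [quadForm]

theorem continuous_quadForm (M : Matrix (Fin d) (Fin d) ℝ) : Continuous (quadForm M) := by
  have : quadForm M = fun x => ∑ i, ∑ j, M i j * (x i * x j) := funext (quadForm_eq_sum M)
  rw [this]; fun_prop

theorem quadForm_pos (hA : A.PosDef) {x : Fin d → ℝ} (hx : x ≠ 0) : 0 < quadForm A x := by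
  simpa [quadForm] using hA.dotProduct_mulVec_pos hx

/-- A positive definite form is comparable to the square of the supremum norm. -/
theorem exists_quadForm_comparable (hA : A.PosDef) :
    ∃ K : ℝ, 1 ≤ K ∧ ∀ x : Fin d → ℝ, K⁻¹ * ‖x‖ ^ 2 ≤ quadForm A x ∧
      quadForm A x ≤ K * ‖x‖ ^ 2 := by
  obtain ⟨m, hm0, hm⟩ : ∃ m : ℝ, 0 < m ∧ ∀ x ∈ Metric.sphere (0 : Fin d → ℝ) 1,
      m ≤ quadForm A x := by
    -- The unit sphere is empty when `d = 0`.
    rcases (Metric.sphere (0 : Fin d → ℝ) 1).eq_empty_or_nonempty with h | h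
    · exact ⟨1, one_pos, by simp [h]⟩
    · obtain ⟨x, hx, hmin⟩ := (isCompact_sphere (0 : Fin d → ℝ) 1).exists_isMinOn h
        (continuous_quadForm A).continuousOn
      refine ⟨quadForm A x, quadForm_pos hA fun h0 => ?_, fun y hy => hmin hy⟩
      simp [h0] at hx
  obtain ⟨M, hM⟩ : ∃ M : ℝ, ∀ x ∈ Metric.sphere (0 : Fin d → ℝ) 1, quadForm A x ≤ M := by
    obtain ⟨M, hM⟩ := (isCompact_sphere (0 : Fin d → ℝ) 1).bddAbove_image
      (continuous_quadForm A).continuousOn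
    exact ⟨M, fun x hx => hM ⟨x, hx, rfl⟩⟩
  refine ⟨max 1 (max m⁻¹ M), le_max_left _ _, fun x => ?_⟩
  rcases eq_or_ne x 0 with rfl | hx
  · simp [quadForm_zero]
  have hx0 : 0 < ‖x‖ := norm_pos_iff.2 hx
  have hu : ‖x‖⁻¹ • x ∈ Metric.sphere (0 : Fin d → ℝ) 1 := by
    simp [norm_smul, hx0.ne']
  have hxe : quadForm A x = ‖x‖ ^ 2 * quadForm A (‖x‖⁻¹ • x) := by
    rw [← quadForm_smul, smul_smul, mul_inv_cancel₀ hx0.ne', one_smul]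
  have hK1 : (max 1 (max m⁻¹ M))⁻¹ ≤ m := by
    rw [inv_le_comm₀ (by positivity) hm0]
    exact (le_max_left _ _).trans (le_max_right _ _)
  have hK2 : M ≤ max 1 (max m⁻¹ M) := (le_max_right _ _).trans (le_max_right _ _)
  rw [hxe, mul_comm, mul_comm (max _ _)]
  exact ⟨mul_le_mul_of_nonneg_left (hK1.trans (hm _ hu)) (by positivity),
    mul_le_mul_of_nonneg_left ((hM _ hu).trans hK2) (by positivity)⟩

/-- An integer vector as a real vector. -/
def intVec (n : Fin d → ℤ) : Fin d → ℝ := fun i => (n i : ℝ)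

theorem intVec_eq_zero {n : Fin d → ℤ} : intVec n = 0 ↔ n = 0 := by
  simp [funext_iff, intVec]

theorem one_le_norm_intVec {n : Fin d → ℤ} (hn : n ≠ 0) : 1 ≤ ‖intVec n‖ := by
  obtain ⟨i, hi⟩ := Function.ne_iff.1 hn
  refine le_trans ?_ (norm_le_pi_norm _ i)
  rw [intVec, Real.norm_eq_abs, ← Int.cast_abs]
  exact_mod_cast Int.one_le_abs hi

/-- Integer vectors embed in the `ℤ`-span of the standard basis, a lattice of rank `d`. -/
theorem summable_norm_intVec_rpow {r : ℝ} (hr : r < -d) :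
    Summable fun n : Fin d → ℤ => ‖intVec n‖ ^ r := by
  let b := Pi.basisFun ℝ (Fin d)
  have hrank : Module.finrank ℤ (Submodule.span ℤ (Set.range b)) = d := by
    rw [ZLattice.rank ℝ]; simp
  have h := ZLattice.summable_norm_rpow (Submodule.span ℤ (Set.range b)) r (by rwa [hrank])
  have hmem : ∀ n : Fin d → ℤ, intVec n ∈ Submodule.span ℤ (Set.range b) := fun n => by
    have : intVec n = ∑ i, n i • b i := by
      ext j
      simp [intVec, b, Finset.sum_apply, Pi.single_apply]
    rw [this]
    exact Submodule.sum_mem _ fun i _ =>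
      Submodule.smul_mem _ _ (Submodule.subset_span ⟨i, rfl⟩)
  have hinj : Function.Injective
      fun n : Fin d → ℤ => (⟨intVec n, hmem n⟩ : Submodule.span ℤ (Set.range b)) :=
    fun m n hmn => by
      ext i
      have h1 : intVec m i = intVec n i := congrFun (congrArg Subtype.val hmn) i
      exact Int.cast_injective h1
  exact (h.comp_injective hinj).congr fun n => rfl

/-- Powers of comparable positive reals are comparable. -/
theorem rpow_le_of_comparable {L m q e : ℝ} (hL : 1 ≤ L) (hm : 0 < m) (h1 : L⁻¹ * m ≤ q)
    (h2 : q ≤ L * m) : q ^ e ≤ L ^ |e| * m ^ e := by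
  have hL0 : 0 < L := by linarith
  have hq : 0 < q := lt_of_lt_of_le (by positivity) h1
  rcases le_total 0 e with he | he
  · rw [abs_of_nonneg he, ← Real.mul_rpow hL0.le hm.le]
    exact Real.rpow_le_rpow hq.le h2 he
  · rw [abs_of_nonpos he, Real.rpow_neg hL0.le, ← Real.inv_rpow hL0.le,
      ← Real.mul_rpow (by positivity) hm.le]
    exact Real.rpow_le_rpow_of_nonpos (by positivity) h1 he

theorem quadFormInt_pos (hA : A.PosDef) {n : Fin d → ℤ} (hn : n ≠ 0) : 0 < quadFormInt A n :=
  quadForm_pos hA (x := intVec n) (by rwa [Ne, intVec_eq_zero])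

theorem summable_quadFormInt_rpow (hA : A.PosDef) {e : ℝ} (he : e < -(d : ℝ) / 2) :
    Summable fun n : {n : Fin d → ℤ // n ≠ 0} => quadFormInt A n.1 ^ e := by
  obtain ⟨K, hK1, hK⟩ := exists_quadForm_comparable hA
  have h := (summable_norm_intVec_rpow (d := d) (r := 2 * e) (by linarith)).subtype {n | n ≠ 0}
  refine Summable.of_nonneg_of_le (fun n => Real.rpow_nonneg (quadFormInt_pos hA n.2).le _)
    (fun n => ?_) (h.mul_left (K ^ |e|))
  have hn := one_le_norm_intVec n.2
  have := rpow_le_of_comparable (e := e) hK1 (m := ‖intVec n.1‖ ^ 2) (by positivity)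
    (hK (intVec n.1)).1 (hK (intVec n.1)).2
  rwa [← Real.rpow_natCast, ← Real.rpow_mul (norm_nonneg _)] at this

/-! ### The Epstein zeta function -/

/-- The theta series of `Q_A`. -/
def theta (A : Matrix (Fin d) (Fin d) ℝ) (t : ℝ) : ℝ :=
  ∑' n : Fin d → ℤ, Real.exp (-Real.pi * quadFormInt A n * t)

theorem exists_theta_approx (hA : A.PosDef) :
    ∃ c : ℝ, 0 < c ∧ ∃ δ : ℝ → ℝ, (∀ r : ℝ, δ =O[𝓝[>] 0] fun t => t ^ r) ∧
      ∀ t : ℝ, 0 < t →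
        HasSum (fun n : Fin d → ℤ => Real.exp (-Real.pi * quadFormInt A n * t)) (theta A t) ∧
        |theta A t - c * t ^ (-(d : ℝ) / 2)| ≤ t ^ (-(d : ℝ) / 2) * δ t := by
  have hQ : ∀ x, A.toQuadraticForm' x = quadForm A x := fun x => by
    rw [Matrix.toQuadraticForm', LinearMap.BilinMap.toQuadraticMap_apply,
      Matrix.toLinearMap₂'_apply', quadForm]
  obtain ⟨c, hc, δ, hδ, h⟩ := exists_gaussian_sum_approx d A.toQuadraticForm' fun x hx => by
    rw [hQ]; exact quadForm_pos hA hx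
  refine ⟨c, hc, δ, hδ, fun t ht => ?_⟩
  obtain ⟨S, hS, hS'⟩ := h t ht 0
  simp only [hQ, add_zero] at hS
  have : theta A t = S := hS.tsum_eq
  rw [this]
  exact ⟨hS, hS'⟩

theorem summable_theta (hA : A.PosDef) {t : ℝ} (ht : 0 < t) :
    Summable fun n : Fin d → ℤ => Real.exp (-Real.pi * quadFormInt A n * t) := by
  obtain ⟨c, hc, δ, hδ, h⟩ := exists_theta_approx hA
  exact (h t ht).1.summable

theorem quadFormInt_nonneg (hA : A.PosDef) (n : Fin d → ℤ) : 0 ≤ quadFormInt A n := by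
  rcases eq_or_ne n 0 with rfl | hn
  · simp [quadFormInt, quadForm]
  · exact (quadFormInt_pos hA hn).le

theorem hasSum_theta_sub_one (hA : A.PosDef) {t : ℝ} (ht : 0 < t) :
    HasSum (fun n : {n : Fin d → ℤ // n ≠ 0} => Real.exp (-Real.pi * quadFormInt A n.1 * t))
      (theta A t - 1) := by
  have h := hasSum_ite_sub_hasSum (summable_theta hA ht).hasSum 0
  have h0 : Real.exp (-Real.pi * quadFormInt A (0 : Fin d → ℤ) * t) = 1 := by
    simp [quadFormInt, quadForm]
  rw [h0] at h
  refine (hasSum_subtype_iff_indicator (s := {n : Fin d → ℤ | n ≠ 0})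
    (f := fun n => Real.exp (-Real.pi * quadFormInt A n * t))).2 ?_
  refine HasSum.congr_fun h fun n => ?_
  by_cases hn : n = 0 <;> simp [hn]

theorem continuousOn_theta (hA : A.PosDef) : ContinuousOn (theta A) (Set.Ioi 0) := by
  intro t (ht : 0 < t)
  have : ContinuousOn (theta A) (Set.Ioi (t / 2)) := by
    refine continuousOn_tsum (fun n => by fun_prop) (summable_theta hA (half_pos ht))
      fun n u (hu : t / 2 < u) => ?_
    rw [Real.norm_of_nonneg (Real.exp_pos _).le, Real.exp_le_exp]
    have := mul_nonneg Real.pi_pos.le (quadFormInt_nonneg hA n)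
    nlinarith
  exact (this.continuousAt (Ioi_mem_nhds (by linarith))).continuousWithinAt

/-- For `n ≠ 0` the form is at least `K⁻¹`, so for `t ≥ 1` each term is at most its value at `t = 1`
times `exp (-π K⁻¹ (t - 1))`. The decay is therefore exponential. -/
theorem theta_sub_one_isBigO (hA : A.PosDef) (r : ℝ) :
    (fun t => theta A t - 1) =O[atTop] fun t => t ^ r := by
  obtain ⟨K, hK1, hK⟩ := exists_quadForm_comparable hA
  have hK0 : 0 < K := by linarith
  have hlow : ∀ n : {n : Fin d → ℤ // n ≠ 0}, K⁻¹ ≤ quadFormInt A n.1 := fun n => by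
    refine le_trans ?_ (hK (intVec n.1)).1
    have := one_le_norm_intVec n.2
    exact le_mul_of_one_le_right (by positivity) (one_le_pow₀ this)
  have hp : 0 < Real.pi * K⁻¹ := by positivity
  refine IsBigO.trans (g := fun t => Real.exp (-(Real.pi * K⁻¹) * t)) ?_
    (isLittleO_exp_neg_mul_rpow_atTop hp r).isBigO
  refine IsBigO.of_bound ((theta A 1 - 1) * Real.exp (Real.pi * K⁻¹)) ?_
  filter_upwards [eventually_ge_atTop 1] with t ht
  have h1 := (hasSum_theta_sub_one hA one_pos).mul_right
    (Real.exp (Real.pi * K⁻¹) * Real.exp (-(Real.pi * K⁻¹) * t))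
  have ht0 : 0 < t := by linarith
  rw [Real.norm_of_nonneg (Real.exp_pos _).le, mul_assoc]
  refine (hasSum_theta_sub_one hA ht0).norm_le_of_bounded h1 fun n => ?_
  rw [Real.norm_of_nonneg (Real.exp_pos _).le, ← Real.exp_add, ← Real.exp_add, Real.exp_le_exp]
  have := hlow n
  have h2 : 0 ≤ Real.pi * ((quadFormInt A n.1 - K⁻¹) * (t - 1)) :=
    mul_nonneg Real.pi_pos.le (mul_nonneg (by linarith) (by linarith))
  linarith

/-- The Epstein zeta function exists; its value at `0` is `-1`. -/
theorem exists_isEpsteinZeta (hd : 1 ≤ d) (hA : A.PosDef) :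
    ∃ Z : ℂ → ℂ, IsEpsteinZeta A Z ∧ Z 0 = -1 := by
  obtain ⟨c, hc, δ, hδ, h⟩ := exists_theta_approx hA
  have hd0 : (0 : ℝ) < d := by exact_mod_cast hd
  have hcontc : ContinuousOn (fun t => (theta A t : ℂ)) (Set.Ioi 0) :=
    Complex.continuous_ofReal.comp_continuousOn (continuousOn_theta hA)
  have hg : ContinuousOn (fun t : ℝ => ((t ^ (-(d : ℝ) / 2) * theta A (1 / t) : ℝ) : ℂ))
      (Set.Ioi 0) := by
    refine Complex.continuous_ofReal.comp_continuousOn (ContinuousOn.mul ?_ ?_)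
    · exact fun t ht => (Real.continuousAt_rpow_const _ _
        (Or.inl (ne_of_gt ht))).continuousWithinAt
    · refine (continuousOn_theta hA).comp ?_ fun t (ht : 0 < t) => by
        simpa using ht
      exact continuousOn_const.div continuousOn_id fun t ht => ne_of_gt ht
  -- The partner `g` is defined to be what the functional equation prescribes, so no dual form
  -- appears. The content lies in `hg_top`, where the relative error of `theta` at `0` becomes an
  -- absolute error at infinity.
  let P : WeakFEPair ℂ :=
    { f := fun t => (theta A t : ℂ)
      g := fun t => ((t ^ (-(d : ℝ) / 2) * theta A (1 / t) : ℝ) : ℂ)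
      k := (d : ℝ) / 2
      ε := 1
      f₀ := 1
      g₀ := c
      hf_int := hcontc.locallyIntegrableOn measurableSet_Ioi
      hg_int := hg.locallyIntegrableOn measurableSet_Ioi
      hk := by positivity
      hε := one_ne_zero
      h_feq := fun x (hx : 0 < x) => by
        rw [one_mul, smul_eq_mul, ← Complex.ofReal_mul, ← mul_assoc, ← Real.rpow_add hx,
          show (d : ℝ) / 2 + -(d : ℝ) / 2 = 0 by ring, Real.rpow_zero, one_mul]
      hf_top := fun r => by
        simpa only [← Complex.ofReal_one, ← Complex.ofReal_sub] using
          Complex.isBigO_ofReal_left.2 (theta_sub_one_isBigO hA r)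
      hg_top := fun r => by
        simp only [← Complex.ofReal_sub]
        refine Complex.isBigO_ofReal_left.2 ?_
        have h1 := (hδ (-r)).comp_tendsto tendsto_inv_atTop_nhdsGT_zero
        refine IsBigO.trans (IsBigO.of_bound 1 ?_) (h1.congr' EventuallyEq.rfl ?_)
        · filter_upwards [eventually_gt_atTop 0] with t ht
          have ht' : 0 < t⁻¹ := by positivity
          have h2 := (h t⁻¹ ht').2
          have h3 : t ^ (-(d : ℝ) / 2) * t⁻¹ ^ (-(d : ℝ) / 2) = 1 := by
            rw [← Real.mul_rpow ht.le ht'.le, mul_inv_cancel₀ ht.ne', Real.one_rpow]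
          have h4 : 0 < t ^ (-(d : ℝ) / 2) := by positivity
          rw [one_mul, Function.comp_apply, one_div]
          calc ‖t ^ (-(d : ℝ) / 2) * theta A t⁻¹ - c‖
              = t ^ (-(d : ℝ) / 2) * |theta A t⁻¹ - c * t⁻¹ ^ (-(d : ℝ) / 2)| := by
                rw [← abs_of_pos h4, ← abs_mul, abs_of_pos h4, Real.norm_eq_abs, mul_sub,
                  mul_left_comm, h3, mul_one]
            _ ≤ t ^ (-(d : ℝ) / 2) * (t⁻¹ ^ (-(d : ℝ) / 2) * δ t⁻¹) := by gcongr
            _ = δ t⁻¹ := by rw [← mul_assoc, h3, one_mul]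
            _ ≤ ‖δ t⁻¹‖ := le_abs_self _
        · filter_upwards [eventually_gt_atTop 0] with t ht
          simp [Real.inv_rpow ht.le, Real.rpow_neg ht.le] }
  -- This is `π^s Γ(s)⁻¹ Λ(s)` with the pole of `Λ` at `0` absorbed through `1 / (s Γ(s)) = 1 / Γ(s
  -- + 1)`. The expression is then regular at `0`, and since `1 / Γ` vanishes there, its value is
  -- `-1`.
  refine ⟨fun s => (Real.pi : ℂ) ^ s * (P.Λ₀ s * (Complex.Gamma s)⁻¹ - (Complex.Gamma (s + 1))⁻¹
    - (Complex.Gamma s)⁻¹ * (c / ((d : ℂ) / 2 - s))), ⟨fun s hs => ?_, ?_⟩, ?_⟩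
  · have hs0 : 0 < s.re := lt_trans (by positivity) hs
    have hs0' : s ≠ 0 := fun h0 => by simp [h0] at hs0
    have hM := (P.hasMellin (s := s) hs).2
    have hsum := hasSum_mellin_pi_mul (ι := {n : Fin d → ℤ // n ≠ 0}) (a := fun _ => 1)
      (q := fun n => quadFormInt A n.1) (F := fun t => P.f t - P.f₀) (s := s)
      (fun n => Or.inr (quadFormInt_pos hA n.2)) hs0
      (fun t ht => by
        have := Complex.hasSum_ofReal.2 (hasSum_theta_sub_one hA ht)
        simpa [P] using this)
      (by
        have := summable_quadFormInt_rpow hA (e := -s.re) (by linarith)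
        refine this.congr fun n => ?_
        rw [Real.rpow_neg (quadFormInt_pos hA n.2).le]; simp)
    rw [hM] at hsum
    have hG : Complex.Gamma s ≠ 0 := Complex.Gamma_ne_zero_of_re_pos hs0
    have hpi : (Real.pi : ℂ) ≠ 0 := by exact_mod_cast Real.pi_ne_zero
    have hpis : (Real.pi : ℂ) ^ s ≠ 0 := by
      simp [Complex.cpow_eq_zero_iff, hpi]
    have hΛ : (Real.pi : ℂ) ^ s * (P.Λ₀ s * (Complex.Gamma s)⁻¹ - (Complex.Gamma (s + 1))⁻¹
        - (Complex.Gamma s)⁻¹ * (c / ((d : ℂ) / 2 - s))) =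
        (Real.pi : ℂ) ^ s * (Complex.Gamma s)⁻¹ * P.Λ s := by
      rw [Complex.Gamma_add_one s hs0', P.Λ₀_eq]
      simp only [P, smul_eq_mul]
      push_cast
      rw [mul_inv]
      ring
    rw [hΛ]
    refine (hsum.mul_left ((Real.pi : ℂ) ^ s * (Complex.Gamma s)⁻¹)).congr_fun fun n => ?_
    rw [Complex.cpow_neg]
    field_simp
  · intro s hs
    have h1 : (d : ℂ) / 2 - s ≠ 0 := fun h0 => hs (by simpa using (sub_eq_zero.1 h0).symm)
    have hpi : (Real.pi : ℂ) ≠ 0 := by exact_mod_cast Real.pi_ne_zero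
    have hGd := Complex.differentiable_one_div_Gamma
    have hG1 : DifferentiableAt ℂ (fun s => (Complex.Gamma s)⁻¹) s := hGd s
    have hG2 : DifferentiableAt ℂ (fun s => (Complex.Gamma (s + 1))⁻¹) s :=
      (hGd (s + 1)).comp s (f := fun s => s + 1) (by fun_prop)
    have hP : DifferentiableAt ℂ (fun s => (Real.pi : ℂ) ^ s) s :=
      differentiableAt_id.const_cpow (Or.inl hpi)
    have hD : DifferentiableAt ℂ (fun s => (c : ℂ) / ((d : ℂ) / 2 - s)) s :=
      (differentiableAt_const _).div (by fun_prop) h1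
    exact (hP.mul ((((P.differentiable_Λ₀ s).mul hG1).sub hG2).sub
      (hG1.mul hD))).differentiableWithinAt
  · simp [Complex.Gamma_zero, Complex.Gamma_one]

end

/-! ### Integration over cubical shells -/

theorem facePoint_same (j : Fin d) (c : ℝ) (y : {i : Fin d // i ≠ j} → ℝ) :
    facePoint j c y j = c := by simp [facePoint]

theorem facePoint_ne (j : Fin d) (c : ℝ) (y : {i : Fin d // i ≠ j} → ℝ)
    (i : {i : Fin d // i ≠ j}) : facePoint j c y i = y i := by
  simp [facePoint, i.2]

theorem facePoint_ne_zero (j : Fin d) {c : ℝ} (hc : c ≠ 0) (y : {i : Fin d // i ≠ j} → ℝ) :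
    facePoint j c y ≠ 0 := fun h => hc (by simpa [facePoint_same] using congrFun h j)

theorem smul_facePoint (j : Fin d) (r c : ℝ) (y : {i : Fin d // i ≠ j} → ℝ) :
    r • facePoint j c y = facePoint j (r * c) (r • y) := by
  ext i
  by_cases h : i = j <;> simp [facePoint, h]

theorem neg_facePoint (j : Fin d) (c : ℝ) (y : {i : Fin d // i ≠ j} → ℝ) :
    -facePoint j c y = facePoint j (-c) (-y) := by
  ext i
  by_cases h : i = j <;> simp [facePoint, h]

theorem norm_facePoint_le_iff (j : Fin d) {r : ℝ} (hr : 0 ≤ r) (y : {i : Fin d // i ≠ j} → ℝ) :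
    ‖facePoint j r y‖ ≤ r ↔ ‖y‖ ≤ r := by
  rw [pi_norm_le_iff_of_nonneg hr, pi_norm_le_iff_of_nonneg hr]
  constructor
  · intro h i
    simpa [facePoint_ne] using h i
  · intro h i
    by_cases hi : i = j
    · subst hi
      rw [facePoint_same, Real.norm_of_nonneg hr]
    · simpa [facePoint_ne j r y ⟨i, hi⟩] using h ⟨i, hi⟩

theorem continuous_facePoint (j : Fin d) :
    Continuous fun p : ℝ × ({i : Fin d // i ≠ j} → ℝ) => facePoint j p.1 p.2 := by
  refine continuous_pi fun i => ?_
  by_cases h : i = j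
  · simp only [facePoint, h, dite_true]; fun_prop
  · simp only [facePoint, h, dite_false]; fun_prop

/-- Splitting off the coordinate `j`. -/
def facePointEquiv (j : Fin d) : ℝ × ({i : Fin d // i ≠ j} → ℝ) ≃ᵐ (Fin d → ℝ) :=
  ((MeasurableEquiv.piEquivPiSubtypeProd (fun _ : Fin d => ℝ) (fun i => i = j)).trans
    ((MeasurableEquiv.funUnique {i : Fin d // i = j} ℝ).prodCongr (MeasurableEquiv.refl _))).symm

theorem facePointEquiv_apply (j : Fin d) (p : ℝ × ({i : Fin d // i ≠ j} → ℝ)) :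
    facePointEquiv j p = facePoint j p.1 p.2 := by
  apply (facePointEquiv j).symm.injective
  rw [MeasurableEquiv.symm_apply_apply]
  refine Prod.ext ?_ ?_
  · change p.1 = facePoint j p.1 p.2 (default : {i : Fin d // i = j}).1
    rw [(default : {i : Fin d // i = j}).2, facePoint_same]
  · funext i
    exact (facePoint_ne j p.1 p.2 i).symm

theorem measurePreserving_facePointEquiv (j : Fin d) :
    MeasurePreserving (facePointEquiv j) := by
  refine MeasurePreserving.symm _ ?_
  have h : MeasurePreserving ((MeasurableEquiv.funUnique {i : Fin d // i = j} ℝ).prodCongr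
      (MeasurableEquiv.refl ({i : Fin d // ¬ i = j} → ℝ))) :=
    (volume_preserving_funUnique {i : Fin d // i = j} ℝ).prod (MeasurePreserving.id volume)
  have h' := volume_preserving_piEquivPiSubtypeProd (fun _ : Fin d => ℝ) (fun i => i = j)
  rw [Subsingleton.elim (Subtype.fintype fun i : Fin d => i = j) (Fintype.subtypeEq j)] at h'
  exact h.comp h'

/-- The part of the shell `a < ‖x‖ ≤ b` on which `ε x_j` is the norm of `x`. -/
def faceCone (j : Fin d) (ε a b : ℝ) : Set (Fin d → ℝ) :=
  {x | a < ε * x j ∧ ε * x j ≤ b ∧ ‖x‖ ≤ ε * x j}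

theorem measurableSet_faceCone (j : Fin d) (ε a b : ℝ) : MeasurableSet (faceCone j ε a b) := by
  have h : Measurable fun x : Fin d → ℝ => ε * x j := by fun_prop
  exact (measurableSet_lt measurable_const h).inter
    ((measurableSet_le h measurable_const).inter (measurableSet_le measurable_norm h))

theorem Icc_neg_one_one_eq_closedBall {ι : Type*} [Fintype ι] :
    Set.Icc (fun _ : ι => (-1 : ℝ)) (fun _ => 1) = Metric.closedBall 0 1 := by
  ext y
  rw [mem_closedBall_zero_iff, pi_norm_le_iff_of_nonneg zero_le_one]
  simp only [Set.mem_Icc, Pi.le_def, Real.norm_eq_abs, abs_le, forall_and]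

/-- A function homogeneous of degree `p` on the punctured space. -/
structure IsHomogeneousFun (F : (Fin d → ℝ) → ℂ) (p : ℂ) : Prop where
  continuousOn : ContinuousOn F {0}ᶜ
  map_smul : ∀ r : ℝ, 0 < r → ∀ x : Fin d → ℝ, x ≠ 0 → F (r • x) = (r : ℂ) ^ p * F x

/-- Polar coordinates for the supremum norm: the slice at height `r` is `r` times the unit face,
which yields `r^{d-1}` from the volume and `r^p` from homogeneity. -/
theorem integral_faceCone {F : (Fin d → ℝ) → ℂ} {p : ℂ} (hF : IsHomogeneousFun F p) (j : Fin d)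
    {a b : ℝ} (ha : 0 < a) (hab : a ≤ b) :
    ∫ x in faceCone j 1 a b, F x = (∫ r in a..b, (r : ℂ) ^ ((d : ℂ) - 1 + p)) *
      ∫ y in Set.Icc (fun _ : {i : Fin d // i ≠ j} => (-1 : ℝ)) (fun _ => 1),
        F (facePoint j 1 y) := by
  have hd : 1 ≤ d := j.pos
  set D : Set (ℝ × ({i : Fin d // i ≠ j} → ℝ)) := {q | q.1 ∈ Set.Ioc a b ∧ ‖q.2‖ ≤ q.1} with hD
  have hDm : MeasurableSet D :=
    (measurableSet_Ioc.preimage measurable_fst).inter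
      (measurableSet_le measurable_snd.norm measurable_fst)
  have hpre : facePointEquiv j ⁻¹' faceCone j 1 a b = D := by
    ext q
    simp only [Set.mem_preimage, faceCone, Set.mem_ofPred_eq, facePointEquiv_apply,
      facePoint_same, one_mul, hD, Set.mem_Ioc, and_assoc]
    refine and_congr_right fun h1 => and_congr_right fun _ => ?_
    exact norm_facePoint_le_iff j (ha.trans h1).le q.2
  rw [← (measurePreserving_facePointEquiv j).setIntegral_preimage_emb
    (facePointEquiv j).measurableEmbedding, hpre]
  simp only [facePointEquiv_apply]
  have hint : IntegrableOn (fun q : ℝ × ({i : Fin d // i ≠ j} → ℝ) => F (facePoint j q.1 q.2)) D := by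
    have hK : IsCompact (Set.Icc a b ×ˢ
        Metric.closedBall (0 : {i : Fin d // i ≠ j} → ℝ) b) :=
      isCompact_Icc.prod (isCompact_closedBall _ _)
    refine (ContinuousOn.integrableOn_compact hK ?_).mono_set fun q hq => ?_
    · refine hF.continuousOn.comp (continuous_facePoint j).continuousOn fun q hq => ?_
      exact facePoint_ne_zero j (ne_of_gt (ha.trans_le hq.1.1)) _
    · exact ⟨Set.Ioc_subset_Icc_self hq.1, mem_closedBall_zero_iff.2 (hq.2.trans hq.1.2)⟩
  rw [← integral_indicator hDm, Measure.volume_eq_prod,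
    integral_prod _ (by rw [← Measure.volume_eq_prod]; exact hint.integrable_indicator hDm)]
  have hinner : ∀ r : ℝ, ∫ y, D.indicator
      (fun q : ℝ × ({i : Fin d // i ≠ j} → ℝ) => F (facePoint j q.1 q.2)) (r, y) =
      (Set.Ioc a b).indicator (fun r : ℝ => (r : ℂ) ^ ((d : ℂ) - 1 + p) *
      ∫ y in Set.Icc (fun _ : {i : Fin d // i ≠ j} => (-1 : ℝ)) (fun _ => 1),
        F (facePoint j 1 y)) r := by
    intro r
    by_cases hr : r ∈ Set.Ioc a b
    · have hr0 : 0 < r := ha.trans hr.1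
      have hrC : (r : ℂ) ≠ 0 := by exact_mod_cast hr0.ne'
      rw [Set.indicator_of_mem hr]
      have h1 : (fun y => D.indicator
          (fun q : ℝ × ({i : Fin d // i ≠ j} → ℝ) => F (facePoint j q.1 q.2)) (r, y)) =
          (Metric.closedBall 0 r).indicator fun y => F (facePoint j r y) := by
        ext y
        by_cases hy : ‖y‖ ≤ r
        · rw [Set.indicator_of_mem (show (r, y) ∈ D from ⟨hr, hy⟩),
            Set.indicator_of_mem (mem_closedBall_zero_iff.2 hy)]
        · rw [Set.indicator_of_notMem (fun h : (r, y) ∈ D => hy h.2),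
            Set.indicator_of_notMem (fun h => hy (mem_closedBall_zero_iff.1 h))]
      rw [h1, integral_indicator Metric.isClosed_closedBall.measurableSet]
      have h2 := Measure.setIntegral_comp_smul_of_pos
        (volume : Measure ({i : Fin d // i ≠ j} → ℝ))
        (fun y => F (facePoint j r y)) (Metric.closedBall 0 1) hr0
      rw [smul_unitClosedBall_of_nonneg hr0.le] at h2
      have h3 : ∀ y, F (facePoint j r (r • y)) = (r : ℂ) ^ p * F (facePoint j 1 y) := fun y => by
        rw [← hF.map_smul r hr0 _ (facePoint_ne_zero j one_ne_zero y), smul_facePoint, mul_one]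
      simp only [h3, integral_const_mul] at h2
      have hfr : Module.finrank ℝ ({i : Fin d // i ≠ j} → ℝ) = d - 1 := by simp
      rw [hfr] at h2
      have hpow : ((r ^ (d - 1) : ℝ) : ℂ) = (r : ℂ) ^ ((d : ℂ) - 1) := by
        rw [Complex.ofReal_pow, ← Complex.cpow_natCast]
        congr 1
        push_cast [Nat.cast_sub hd]; ring
      rw [Icc_neg_one_one_eq_closedBall, Complex.cpow_add _ _ hrC, mul_assoc, h2, ← hpow,
        Complex.real_smul, ← mul_assoc, ← Complex.ofReal_mul, mul_inv_cancel₀ (by positivity),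
        Complex.ofReal_one, one_mul]
    · rw [Set.indicator_of_notMem hr]
      have h1 : (fun y => D.indicator
          (fun q : ℝ × ({i : Fin d // i ≠ j} → ℝ) => F (facePoint j q.1 q.2)) (r, y)) =
          fun _ => 0 := by
        ext y
        rw [Set.indicator_of_notMem (fun h : (r, y) ∈ D => hr h.1)]
      rw [h1, integral_zero]
  simp only [hinner]
  rw [integral_indicator measurableSet_Ioc, intervalIntegral.integral_of_le hab,
    integral_mul_const]

theorem integral_faceCone_neg {F : (Fin d → ℝ) → ℂ} {p : ℂ} (hF : IsHomogeneousFun F p)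
    (j : Fin d) {a b : ℝ} (ha : 0 < a) (hab : a ≤ b) :
    ∫ x in faceCone j (-1) a b, F x = (∫ r in a..b, (r : ℂ) ^ ((d : ℂ) - 1 + p)) *
      ∫ y in Set.Icc (fun _ : {i : Fin d // i ≠ j} => (-1 : ℝ)) (fun _ => 1),
        F (facePoint j (-1) y) := by
  have hF' : IsHomogeneousFun (fun x => F (-x)) p :=
    ⟨hF.continuousOn.comp continuous_neg.continuousOn fun x hx => by simpa using hx,
      fun r hr x hx => by rw [← smul_neg]; exact hF.map_smul r hr _ (neg_ne_zero.2 hx)⟩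
  have h1 : Neg.neg ⁻¹' faceCone j (-1) a b = faceCone j 1 a b := by
    ext x; simp [faceCone]
  rw [← (Measure.measurePreserving_neg (volume : Measure (Fin d → ℝ))).setIntegral_preimage_emb
    (MeasurableEquiv.neg _).measurableEmbedding, h1, integral_faceCone hF' j ha hab]
  congr 1
  have h2 : Neg.neg ⁻¹' Set.Icc (fun _ : {i : Fin d // i ≠ j} => (-1 : ℝ)) (fun _ => 1) =
      Set.Icc (fun _ : {i : Fin d // i ≠ j} => (-1 : ℝ)) (fun _ => 1) := by
    rw [Icc_neg_one_one_eq_closedBall]; ext y; simp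
  conv_rhs => rw [← (Measure.measurePreserving_neg
    (volume : Measure ({i : Fin d // i ≠ j} → ℝ))).setIntegral_preimage_emb
    (MeasurableEquiv.neg _).measurableEmbedding, h2]
  simp only [neg_facePoint]

theorem isCompact_closedBall_diff_ball (a b : ℝ) :
    IsCompact (Metric.closedBall (0 : Fin d → ℝ) b \ Metric.ball 0 a) :=
  (isCompact_closedBall _ _).diff Metric.isOpen_ball

theorem integrableOn_shell {F : (Fin d → ℝ) → ℂ} (hF : ContinuousOn F {0}ᶜ) {a : ℝ}
    (ha : 0 < a) (b : ℝ) :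
    IntegrableOn F (Metric.closedBall 0 b \ Metric.ball 0 a) := by
  refine ContinuousOn.integrableOn_compact (isCompact_closedBall_diff_ball a b)
    (hF.mono fun x hx => ?_)
  rintro rfl
  exact hx.2 (by simpa using ha)

/-- Cones over faces with different axes meet inside such a hyperplane, a proper subspace. -/
theorem volume_eq_signed_coordinates {i j : Fin d} (hij : i ≠ j) (ε ε' : ℝ) (hε : ε ≠ 0) :
    volume {x : Fin d → ℝ | ε * x i = ε' * x j} = 0 := by
  let l : (Fin d → ℝ) →ₗ[ℝ] ℝ := ε • LinearMap.proj i - ε' • LinearMap.proj j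
  have h : {x : Fin d → ℝ | ε * x i = ε' * x j} = (LinearMap.ker l : Set (Fin d → ℝ)) := by
    ext x
    simp [l, sub_eq_zero]
  rw [h]
  refine Measure.addHaar_submodule _ _ fun htop => hε ?_
  have : (Pi.single i 1 : Fin d → ℝ) ∈ LinearMap.ker l := by rw [htop]; trivial
  simpa [l, hij.symm] using this

/-- Integration of a homogeneous function over a cubical shell. -/
theorem integral_shell {F : (Fin d → ℝ) → ℂ} {p : ℂ} (hF : IsHomogeneousFun F p)
    {a b : ℝ} (ha : 0 < a) (hab : a ≤ b) :
    ∫ x in Metric.closedBall 0 b \ Metric.closedBall 0 a, F x =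
      (∫ r in a..b, (r : ℂ) ^ ((d : ℂ) - 1 + p)) * cubeBoundaryIntegral F := by
  let sg : Bool → ℝ := fun e => if e then 1 else -1
  have hsg : ∀ e, sg e = 1 ∨ sg e = -1 := fun e => by cases e <;> simp [sg]
  let C : Fin d × Bool → Set (Fin d → ℝ) := fun k => faceCone k.1 (sg k.2) a b
  have hnorm : ∀ k, ∀ x ∈ C k, ‖x‖ = sg k.2 * x k.1 := fun k x hx => by
    refine le_antisymm hx.2.2 ?_
    refine le_trans ?_ (norm_le_pi_norm x k.1)
    rw [Real.norm_eq_abs]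
    rcases hsg k.2 with h | h <;> rw [h]
    · simpa using le_abs_self _
    · simpa using neg_le_abs _
  have hU : (⋃ k, C k) = Metric.closedBall 0 b \ Metric.closedBall 0 a := by
    ext x
    simp only [Set.mem_iUnion, Set.mem_sdiff, mem_closedBall_zero_iff, not_le]
    constructor
    · rintro ⟨k, hx⟩
      have := hnorm k x hx
      rw [this]
      exact ⟨hx.2.1, hx.1⟩
    · rintro ⟨hb, hxa⟩
      have hx0 : 0 < ‖x‖ := ha.trans hxa
      have hne : Nonempty (Fin d) := by
        by_contra hemp
        rw [not_nonempty_iff] at hemp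
        rw [Subsingleton.elim x 0, norm_zero] at hx0
        exact lt_irrefl _ hx0
      obtain ⟨j, hj⟩ := Finite.exists_max fun i => ‖x i‖
      have hj' : |x j| = ‖x‖ :=
        le_antisymm (norm_le_pi_norm x j) ((pi_norm_le_iff_of_nonneg (norm_nonneg _)).2 hj)
      rcases abs_choice (x j) with h | h
      · refine ⟨(j, true), ?_⟩
        have : sg true * x j = ‖x‖ := by simp [sg, ← hj', h]
        simp only [C, faceCone, Set.mem_ofPred_eq, this]
        exact ⟨hxa, hb, le_rfl⟩
      · refine ⟨(j, false), ?_⟩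
        have : sg false * x j = ‖x‖ := by simp [sg, ← hj', h]
        simp only [C, faceCone, Set.mem_ofPred_eq, this]
        exact ⟨hxa, hb, le_rfl⟩
  -- Opposite faces give disjoint cones because `a > 0`. For different axes, points of the overlap
  -- satisfy `± x i = ‖x‖ = ± x j`.
  have hdisj : Pairwise (Function.onFun (AEDisjoint volume) C) := by
    rintro ⟨i, e⟩ ⟨j, e'⟩ hne
    by_cases hij : i = j
    · subst hij
      refine Disjoint.aedisjoint (Set.disjoint_left.2 fun x hx hx' => ?_)
      have h1 : a < sg e * x i := hx.1
      have h2 : a < sg e' * x i := hx'.1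
      cases e <;> cases e' <;> simp [sg] at hne h1 h2 <;> linarith
    · refine measure_mono_null (fun x hx => ?_) (volume_eq_signed_coordinates hij (sg e) (sg e')
        (by rcases hsg e with h | h <;> rw [h] <;> norm_num))
      exact (hnorm _ x hx.1).symm.trans (hnorm _ x hx.2)
  have hint : IntegrableOn F (⋃ k, C k) := by
    rw [hU]
    exact (integrableOn_shell hF.continuousOn ha b).mono_set
      (Set.sdiff_subset_sdiff_right Metric.ball_subset_closedBall)
  rw [← hU, integral_iUnion_ae
    (fun k => (measurableSet_faceCone _ _ _ _).nullMeasurableSet) hdisj hint, tsum_fintype,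
    Fintype.sum_prod_type, cubeBoundaryIntegral, Finset.mul_sum]
  refine Finset.sum_congr rfl fun j _ => ?_
  rw [Fintype.sum_bool, mul_add]
  simp only [sg, if_true, Bool.false_eq_true, if_false]
  rw [integral_faceCone hF j ha hab, integral_faceCone_neg hF j ha hab]

/-! ### The function `Q^{-s}` and its Laplacian -/

/-- `Q_A(x)^{-s}`. -/
def qPow (A : Matrix (Fin d) (Fin d) ℝ) (s : ℂ) (x : Fin d → ℝ) : ℂ :=
  1 / ((quadForm A x : ℝ) : ℂ) ^ s

/-- `Q_{B(s)}(x) / Q_A(x)^{s+2}`, which is `-1 / (2 s)` times the Laplacian of `Q_A^{-s}`. -/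
def qLap (A : Matrix (Fin d) (Fin d) ℝ) (s : ℂ) (x : Fin d → ℝ) : ℂ :=
  quadForm (matB A s) (fun i => (x i : ℂ)) / ((quadForm A x : ℝ) : ℂ) ^ (s + 2)

theorem qPow_eq (s : ℂ) (x : Fin d → ℝ) :
    qPow A s x = ((quadForm A x : ℝ) : ℂ) ^ (-s) := by
  rw [qPow, Complex.cpow_neg, one_div]

theorem quadForm_matB (s : ℂ) (x : Fin d → ℝ) :
    quadForm (matB A s) (fun i => (x i : ℂ)) =
      A.trace * quadForm A x - 2 * (s + 1) * quadForm (A ^ 2) x := by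
  have h : ∀ M : Matrix (Fin d) (Fin d) ℝ, ((quadForm M x : ℝ) : ℂ) =
      ∑ i, ∑ j, (M i j : ℂ) * (x i * x j) := fun M => by
    rw [quadForm_eq_sum]; push_cast; rfl
  rw [h, h, quadForm_eq_sum]
  simp only [matB, Matrix.sub_apply, Matrix.smul_apply, Matrix.map_apply, smul_eq_mul, sub_mul,
    Finset.sum_sub_distrib, Finset.mul_sum, mul_assoc]

theorem qLap_eq (s : ℂ) (x : Fin d → ℝ) :
    qLap A s x = (A.trace * quadForm A x - 2 * (s + 1) * quadForm (A ^ 2) x) *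
      ((quadForm A x : ℝ) : ℂ) ^ (-(s + 2)) := by
  rw [qLap, quadForm_matB, Complex.cpow_neg, div_eq_mul_inv]

theorem continuousOn_quadForm_cpow (hA : A.PosDef) (s : ℂ) :
    ContinuousOn (fun x : Fin d → ℝ => ((quadForm A x : ℝ) : ℂ) ^ s) {0}ᶜ :=
  ContinuousOn.cpow (Complex.continuous_ofReal.comp (continuous_quadForm A)).continuousOn
    continuousOn_const fun _ hx => Complex.ofReal_mem_slitPlane.2 (quadForm_pos hA hx)

theorem quadForm_smul_cpow {r : ℝ} (hr : 0 < r) (hA : A.PosDef) {x : Fin d → ℝ} (hx : x ≠ 0)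
    (s : ℂ) : ((quadForm A (r • x) : ℝ) : ℂ) ^ s =
      (r : ℂ) ^ (2 * s) * ((quadForm A x : ℝ) : ℂ) ^ s := by
  have hrC : (r : ℂ) ≠ 0 := by exact_mod_cast hr.ne'
  rw [quadForm_smul, sq, Complex.ofReal_mul,
    Complex.mul_cpow_ofReal_nonneg (by positivity) (quadForm_pos hA hx).le, Complex.ofReal_mul,
    Complex.mul_cpow_ofReal_nonneg hr.le hr.le, ← Complex.cpow_add _ _ hrC, two_mul]

theorem isHomogeneousFun_qPow (hA : A.PosDef) (s : ℂ) :
    IsHomogeneousFun (qPow A s) (-2 * s) := by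
  refine ⟨?_, fun r hr x hx => ?_⟩
  · rw [funext (qPow_eq (A := A) s)]
    exact continuousOn_quadForm_cpow hA _
  · rw [qPow_eq, qPow_eq, quadForm_smul_cpow hr hA hx]
    congr 2; ring

theorem isHomogeneousFun_qLap (hA : A.PosDef) (s : ℂ) :
    IsHomogeneousFun (qLap A s) (-2 * s - 2) := by
  refine ⟨?_, fun r hr x hx => ?_⟩
  · rw [funext (qLap_eq (A := A) s)]
    have h1 := continuous_quadForm A
    have h2 := continuous_quadForm (A ^ 2)
    exact (Continuous.continuousOn (by fun_prop)).mul (continuousOn_quadForm_cpow hA _)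
  · have hrC : (r : ℂ) ≠ 0 := by exact_mod_cast hr.ne'
    have h3 : (r : ℂ) ^ (-2 * s - 2) = (r : ℂ) ^ 2 * (r : ℂ) ^ (2 * -(s + 2)) := by
      rw [← Complex.cpow_natCast, ← Complex.cpow_add _ _ hrC]
      congr 1; push_cast; ring
    rw [qLap_eq, qLap_eq, quadForm_smul_cpow hr hA hx, quadForm_smul, quadForm_smul, h3]
    push_cast
    ring

/-- The boundary integral of `Q^{-s}`. -/
def bdryPow (A : Matrix (Fin d) (Fin d) ℝ) (s : ℂ) : ℂ := cubeBoundaryIntegral (qPow A s)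

/-- The shell avoids the origin, so the formula holds on both sides of the line `Re s = d/2`; the
analytic continuation relies on this. -/
theorem integral_shell_qPow (hA : A.PosDef) {s : ℂ} (hs : s ≠ (d : ℂ) / 2) {a b : ℝ}
    (ha : 0 < a) (hab : a ≤ b) :
    ∫ x in Metric.closedBall 0 b \ Metric.closedBall 0 a, qPow A s x =
      ((b : ℂ) ^ ((d : ℂ) - 2 * s) - (a : ℂ) ^ ((d : ℂ) - 2 * s)) / ((d : ℂ) - 2 * s)
        * bdryPow A s := by
  rw [integral_shell (isHomogeneousFun_qPow hA s) ha hab, integral_cpow, bdryPow]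
  · rw [show (d : ℂ) - 1 + -2 * s + 1 = d - 2 * s by ring]
  · refine Or.inr ⟨fun h => hs ?_, fun h => ?_⟩
    · linear_combination (1 / 2 : ℂ) * (-h)
    · rw [Set.uIcc_of_le hab] at h
      exact absurd h.1 (not_le.2 ha)

theorem integral_shell_qLap (hA : A.PosDef) (s : ℂ) {a b : ℝ} (ha : 0 < a) (hab : a ≤ b) :
    ∫ x in Metric.closedBall 0 b \ Metric.closedBall 0 a, qLap A s x =
      (∫ r in a..b, (r : ℂ) ^ ((d : ℂ) - 3 - 2 * s)) * V A s := by
  rw [integral_shell (isHomogeneousFun_qLap hA s) ha hab, V,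
    show (d : ℂ) - 1 + (-2 * s - 2) = d - 3 - 2 * s by ring]
  rfl

theorem norm_ofReal_cpow_le {K m q : ℝ} (hK : 1 ≤ K) (hm : 0 < m) (h1 : K⁻¹ * m ≤ q)
    (h2 : q ≤ K * m) (s : ℂ) : ‖(q : ℂ) ^ s‖ ≤ K ^ |s.re| * m ^ s.re := by
  have hK0 : 0 < K := by linarith
  have hq : 0 < q := lt_of_lt_of_le (by positivity) h1
  rw [Complex.norm_cpow_eq_rpow_re_of_pos hq]
  exact rpow_le_of_comparable hK hm h1 h2

/-- Local integrability of `Q^{-s}`. -/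
theorem locallyIntegrable_qPow (hd : 1 ≤ d) (hA : A.PosDef) {s : ℂ} (hs : s.re < (d : ℝ) / 2) :
    LocallyIntegrable (qPow A s) := by
  obtain ⟨K, hK1, hK⟩ := exists_quadForm_comparable hA
  have hfr : Module.finrank ℝ (Fin d → ℝ) = d := by simp
  have hnt : Nontrivial (Fin d → ℝ) :=
    Module.nontrivial_of_finrank_pos (R := ℝ) (by rw [hfr]; exact hd)
  refine locallyIntegrable_of_norm_le_rpow (C := K ^ |(-s).re|) (α := 2 * s.re)
    (by rw [hfr]; exact hd) (by rw [hfr]; linarith) ?_ ?_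
  · have h0 : ∀ᵐ x : Fin d → ℝ, x ≠ 0 := by
      rw [ae_iff]
      simp
    filter_upwards [h0] with x hx
    have hx' : 0 < ‖x‖ := norm_pos_iff.2 hx
    rw [qPow_eq]
    refine (norm_ofReal_cpow_le hK1 (by positivity) (hK x).1 (hK x).2 (-s)).trans_eq ?_
    rw [← Real.rpow_natCast, ← Real.rpow_mul hx'.le]
    congr 2
    simp
  · have h1 : Measurable fun x : Fin d → ℝ => ((quadForm A x : ℝ) : ℂ) :=
      (Complex.continuous_ofReal.comp (continuous_quadForm A)).measurable
    have h2 : Measurable (qPow A s) := by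
      rw [funext (qPow_eq (A := A) s)]
      exact h1.pow_const (-s)
    exact h2.aestronglyMeasurable

theorem closedBall_eq_Icc {ι : Type*} [Fintype ι] (c : ι → ℝ) {r : ℝ} (hr : 0 ≤ r) :
    Metric.closedBall c r = Set.Icc (fun i => c i - r) (fun i => c i + r) := by
  rw [closedBall_pi _ hr, ← Set.pi_univ_Icc]
  simp only [Real.closedBall_eq_Icc]

theorem cube_eq_closedBall (N : ℕ) : cube d N = Metric.closedBall 0 ((N : ℝ) + 1 / 2) := by
  rw [closedBall_eq_Icc _ (by positivity), cube]
  congr 1 <;> ext i <;> simp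
  ring

theorem integral_closedBall_qPow (hd : 1 ≤ d) (hA : A.PosDef) {s : ℂ}
    (hs : s.re < (d : ℝ) / 2) {b : ℝ} (hb : 0 < b) :
    ∫ x in Metric.closedBall 0 b, qPow A s x =
      (b : ℂ) ^ ((d : ℂ) - 2 * s) / ((d : ℂ) - 2 * s) * bdryPow A s := by
  have hfr : Module.finrank ℝ (Fin d → ℝ) = d := by simp
  have hnt : Nontrivial (Fin d → ℝ) :=
    Module.nontrivial_of_finrank_pos (R := ℝ) (by rw [hfr]; exact hd)
  have hs' : s ≠ (d : ℂ) / 2 := fun h => by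
    rw [h, show ((d : ℂ) / 2) = (((d : ℝ) / 2 : ℝ) : ℂ) by push_cast; rfl, Complex.ofReal_re] at hs
    exact lt_irrefl _ hs
  -- The punctured ball is exhausted by shells of inner radius `a n → 0`. Their inner boundary term
  -- `a^{d-2s}` vanishes in the limit because `Re s < d/2`.
  let a : ℕ → ℝ := fun n => b / ((n : ℝ) + 1)
  have ha : ∀ n, 0 < a n := fun n => by positivity
  have hab : ∀ n, a n ≤ b := fun n => div_le_self hb.le (by linarith [Nat.cast_nonneg (α := ℝ) n])
  have ha0 : Tendsto a atTop (𝓝 0) := by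
    have := (tendsto_one_div_add_atTop_nhds_zero_nat (𝕜 := ℝ)).const_mul b
    simpa [a, div_eq_mul_inv] using this
  let S : ℕ → Set (Fin d → ℝ) := fun n => Metric.closedBall 0 b \ Metric.closedBall 0 (a n)
  have hmono : Monotone S := fun m n hmn => by
    refine Set.sdiff_subset_sdiff_right (Metric.closedBall_subset_closedBall ?_)
    simp only [a]
    gcongr
  have hU : (⋃ n, S n) = Metric.closedBall 0 b \ {0} := by
    ext x
    simp only [S, Set.mem_iUnion, Set.mem_sdiff, mem_closedBall_zero_iff, not_le,
      Set.mem_singleton_iff]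
    constructor
    · rintro ⟨n, h1, h2⟩
      exact ⟨h1, fun h0 => by rw [h0, norm_zero] at h2; exact lt_asymm h2 (ha n)⟩
    · rintro ⟨h1, h2⟩
      obtain ⟨n, hn⟩ := (ha0.eventually_lt_const (norm_pos_iff.2 h2)).exists
      exact ⟨n, h1, hn⟩
  have hae : (Metric.closedBall 0 b \ {0} : Set (Fin d → ℝ)) =ᵐ[volume] Metric.closedBall 0 b :=
    sdiff_null_ae_eq_self (measure_singleton 0)
  have hint : IntegrableOn (qPow A s) (⋃ n, S n) := by
    rw [hU]
    exact ((locallyIntegrable_qPow hd hA hs).integrableOn_isCompact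
      (isCompact_closedBall _ _)).mono_set Set.sdiff_subset
  have hlim := tendsto_setIntegral_of_monotone
    (fun n => Metric.isClosed_closedBall.measurableSet.diff
      Metric.isClosed_closedBall.measurableSet) hmono hint
  rw [hU, setIntegral_congr_set hae] at hlim
  refine tendsto_nhds_unique hlim ?_
  simp only [integral_shell_qPow hA hs' (ha _) (hab _)]
  have hpow : Tendsto (fun n => ((a n : ℝ) : ℂ) ^ ((d : ℂ) - 2 * s)) atTop (𝓝 0) := by
    rw [tendsto_zero_iff_norm_tendsto_zero]
    have hre : 0 < ((d : ℂ) - 2 * s).re := by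
      simp; linarith
    have h1 : ∀ n, ‖((a n : ℝ) : ℂ) ^ ((d : ℂ) - 2 * s)‖ = a n ^ ((d : ℂ) - 2 * s).re :=
      fun n => Complex.norm_cpow_eq_rpow_re_of_pos (ha n) _
    simp only [h1]
    have := (Real.continuousAt_rpow_const 0 _ (Or.inr hre.le)).tendsto.comp ha0
    rwa [Real.zero_rpow hre.ne'] at this
  have := ((tendsto_const_nhds (x := (b : ℂ) ^ ((d : ℂ) - 2 * s))).sub hpow).div_const
    ((d : ℂ) - 2 * s) |>.mul_const (bdryPow A s)
  rwa [sub_zero] at this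

theorem betaN_eq (hd : 1 ≤ d) (hA : A.PosDef) {s : ℂ} (hs : s.re < (d : ℝ) / 2) (N : ℕ) :
    betaN A N s = (((N : ℝ) + 1 / 2 : ℝ) : ℂ) ^ ((d : ℂ) - 2 * s) / ((d : ℂ) - 2 * s)
      * bdryPow A s := by
  rw [betaN, cube_eq_closedBall]
  exact integral_closedBall_qPow hd hA hs (by positivity)

/-! ### Holomorphic dependence on the exponent -/

theorem differentiable_integral_cpow {ι : Type*} [Fintype ι] {K : Set (ι → ℝ)} (hK : IsCompact K)
    {p q : (ι → ℝ) → ℝ} (hp : ContinuousOn p K) (hq : ContinuousOn q K) (hq0 : ∀ x ∈ K, 0 < q x) :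
    Differentiable ℂ fun s : ℂ => ∫ x in K, (p x : ℂ) * (q x : ℂ) ^ (-s) := by
  intro s
  have hpC : ContinuousOn (fun x => (p x : ℂ)) K := Complex.continuous_ofReal.comp_continuousOn hp
  have hqC : ContinuousOn (fun x => (q x : ℂ)) K := Complex.continuous_ofReal.comp_continuousOn hq
  have hlog : ContinuousOn (fun x => Complex.log (q x)) K :=
    hqC.clog fun x hx => Complex.ofReal_mem_slitPlane.2 (hq0 x hx)
  have hF : ∀ z : ℂ, ContinuousOn (fun x => (p x : ℂ) * (q x : ℂ) ^ (-z)) K := fun z =>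
    hpC.mul (hqC.cpow continuousOn_const fun x hx => Complex.ofReal_mem_slitPlane.2 (hq0 x hx))
  have hF' : ContinuousOn (fun w : ℂ × (ι → ℝ) =>
      (p w.2 : ℂ) * ((q w.2 : ℂ) ^ (-w.1) * Complex.log (q w.2) * -1))
      (Metric.closedBall s 1 ×ˢ K) := by
    have hsnd : ContinuousOn (Prod.snd : ℂ × (ι → ℝ) → ι → ℝ) (Metric.closedBall s 1 ×ˢ K) :=
      continuous_snd.continuousOn
    have hmaps : Set.MapsTo (Prod.snd : ℂ × (ι → ℝ) → ι → ℝ) (Metric.closedBall s 1 ×ˢ K) K :=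
      fun w hw => hw.2
    refine (hpC.comp hsnd hmaps).mul
      ((ContinuousOn.mul ?_ (hlog.comp hsnd hmaps)).mul continuousOn_const)
    exact (hqC.comp hsnd hmaps).cpow continuous_fst.neg.continuousOn fun w hw =>
      Complex.ofReal_mem_slitPlane.2 (hq0 _ hw.2)
  obtain ⟨C, hC⟩ := ((isCompact_closedBall s 1).prod hK).exists_bound_of_continuousOn hF'
  have hKm : MeasurableSet K := hK.isClosed.measurableSet
  have hfin : IsFiniteMeasure (volume.restrict K) :=
    ⟨by rw [Measure.restrict_apply_univ]; exact hK.measure_lt_top⟩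
  have hF's : ContinuousOn (fun x => (p x : ℂ) * ((q x : ℂ) ^ (-s) * Complex.log (q x) * -1)) K :=
    hF'.comp (f := fun x => (s, x)) (by fun_prop) fun x hx =>
      ⟨Metric.mem_closedBall_self zero_le_one, hx⟩
  refine (hasDerivAt_integral_of_dominated_loc_of_deriv_le (bound := fun _ => C)
    (F := fun (s : ℂ) x => (p x : ℂ) * (q x : ℂ) ^ (-s))
    (F' := fun s x => (p x : ℂ) * ((q x : ℂ) ^ (-s) * Complex.log (q x) * -1))
    (Metric.closedBall_mem_nhds s one_pos) ?_ ?_ ?_ ?_ ?_ ?_).2.differentiableAt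
  · exact Eventually.of_forall fun z => (hF z).aestronglyMeasurable hKm
  · exact (hF s).integrableOn_compact hK
  · exact hF's.aestronglyMeasurable hKm
  · exact (ae_restrict_iff' hKm).2 (Eventually.of_forall fun x hx z hz => hC (z, x) ⟨hz, hx⟩)
  · exact integrable_const C
  · refine (ae_restrict_iff' hKm).2 (Eventually.of_forall fun x hx z _ => ?_)
    refine HasDerivAt.const_mul _ ((hasDerivAt_neg z).const_cpow (Or.inl ?_))
    exact_mod_cast (hq0 x hx).ne'

section parametric

variable {ι : Type*} [Fintype ι] {K : Set (ι → ℝ)} {φ : (ι → ℝ) → Fin d → ℝ}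

theorem differentiable_integral_qPow (hA : A.PosDef) (hK : IsCompact K) (hφ : ContinuousOn φ K)
    (h0 : ∀ x ∈ K, φ x ≠ 0) : Differentiable ℂ fun s : ℂ => ∫ x in K, qPow A s (φ x) := by
  have := differentiable_integral_cpow hK (p := fun _ => 1) continuousOn_const
    ((continuous_quadForm A).comp_continuousOn hφ) fun x hx => quadForm_pos hA (h0 x hx)
  simpa [qPow_eq] using this

theorem differentiable_integral_qLap (hA : A.PosDef) (hK : IsCompact K) (hφ : ContinuousOn φ K)
    (h0 : ∀ x ∈ K, φ x ≠ 0) : Differentiable ℂ fun s : ℂ => ∫ x in K, qLap A s (φ x) := by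
  have hq : ContinuousOn (fun x => quadForm A (φ x)) K :=
    (continuous_quadForm A).comp_continuousOn hφ
  have hq2 : ContinuousOn (fun x => quadForm (A ^ 2) (φ x)) K :=
    (continuous_quadForm (A ^ 2)).comp_continuousOn hφ
  have hpos : ∀ x ∈ K, 0 < quadForm A (φ x) := fun x hx => quadForm_pos hA (h0 x hx)
  have hq1 : ContinuousOn (fun x => A.trace * quadForm A (φ x)) K := continuousOn_const.mul hq
  have h1 := differentiable_integral_cpow hK hq1 hq hpos
  have h2 := differentiable_integral_cpow hK hq2 hq hpos
  have hint : ∀ (p : (ι → ℝ) → ℝ), ContinuousOn p K → ∀ s : ℂ, IntegrableOn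
      (fun x => (p x : ℂ) * ((quadForm A (φ x) : ℝ) : ℂ) ^ (-(s + 2))) K := fun p hp s =>
    ((Complex.continuous_ofReal.comp_continuousOn hp).mul
      ((Complex.continuous_ofReal.comp_continuousOn hq).cpow continuousOn_const fun x hx =>
        Complex.ofReal_mem_slitPlane.2 (hpos x hx))).integrableOn_compact hK
  -- The matrix `B(s)` is affine in `s`, so the integral splits into two pure power integrals at
  -- exponent `s + 2`.
  have heq : (fun s : ℂ => ∫ x in K, qLap A s (φ x)) = fun s : ℂ =>
      (∫ x in K, ((A.trace * quadForm A (φ x) : ℝ) : ℂ) *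
        ((quadForm A (φ x) : ℝ) : ℂ) ^ (-(s + 2))) -
      2 * (s + 1) * ∫ x in K, ((quadForm (A ^ 2) (φ x) : ℝ) : ℂ) *
        ((quadForm A (φ x) : ℝ) : ℂ) ^ (-(s + 2)) := by
    ext s
    rw [← integral_const_mul, ← integral_sub (hint _ hq1 s)
      ((hint _ hq2 s).const_mul _)]
    refine integral_congr_ae (Eventually.of_forall fun x => ?_)
    simp only [qLap_eq]
    push_cast
    ring
  rw [heq]
  have hsh : Differentiable ℂ fun s : ℂ => s + 2 := by fun_prop
  have hlin : Differentiable ℂ fun s : ℂ => 2 * (s + 1) := by fun_prop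
  exact (h1.comp hsh).sub (hlin.mul (h2.comp hsh))

end parametric

theorem continuous_facePoint_right (j : Fin d) (c : ℝ) : Continuous (facePoint j c) :=
  (continuous_facePoint j).comp (f := fun y => (c, y)) (by fun_prop)

theorem differentiable_bdryPow (hA : A.PosDef) : Differentiable ℂ (bdryPow A) := by
  unfold bdryPow cubeBoundaryIntegral
  refine Differentiable.fun_sum fun j _ => Differentiable.add ?_ ?_
  · exact differentiable_integral_qPow hA isCompact_Icc
      (continuous_facePoint_right j 1).continuousOn fun y _ => facePoint_ne_zero j (by norm_num) y
  · exact differentiable_integral_qPow hA isCompact_Icc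
      (continuous_facePoint_right j (-1)).continuousOn
      fun y _ => facePoint_ne_zero j (by norm_num) y

theorem differentiable_V (hA : A.PosDef) : Differentiable ℂ (V A) := by
  have h : V A = fun s => cubeBoundaryIntegral (qLap A s) := rfl
  rw [h]
  unfold cubeBoundaryIntegral
  refine Differentiable.fun_sum fun j _ => Differentiable.add ?_ ?_
  · exact differentiable_integral_qLap hA isCompact_Icc
      (continuous_facePoint_right j 1).continuousOn fun y _ => facePoint_ne_zero j (by norm_num) y
  · exact differentiable_integral_qLap hA isCompact_Icc
      (continuous_facePoint_right j (-1)).continuousOn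
      fun y _ => facePoint_ne_zero j (by norm_num) y

/-! ### Unit cells -/

/-- The integer points of `[-N, N]^d` other than the origin. -/
def puncturedBox (d N : ℕ) : Finset (Fin d → ℤ) :=
  (Finset.Icc (fun _ => -(N : ℤ)) (fun _ => (N : ℤ))).erase 0

/-- The closed unit cube centred at an integer point. -/
def cell (n : Fin d → ℤ) : Set (Fin d → ℝ) := Metric.closedBall (intVec n) (1 / 2)

/-- The half-open unit cube centred at an integer point. -/
def halfOpenCell (n : Fin d → ℤ) : Set (Fin d → ℝ) := {x | ∀ i, ⌊x i + 1 / 2⌋ = n i}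

theorem halfOpenCell_eq (n : Fin d → ℤ) : halfOpenCell n =
    Set.univ.pi fun i => Set.Ico ((n i : ℝ) - 1 / 2) ((n i : ℝ) + 1 / 2) := by
  ext x
  simp only [halfOpenCell, Set.mem_ofPred_eq, Set.mem_univ_pi, Set.mem_Ico, Int.floor_eq_iff]
  refine forall_congr' fun i => ?_
  constructor <;> rintro ⟨h1, h2⟩ <;> constructor <;> linarith

theorem halfOpenCell_ae_eq (n : Fin d → ℤ) : halfOpenCell n =ᵐ[volume] cell n := by
  rw [halfOpenCell_eq, cell, closedBall_eq_Icc _ (by norm_num)]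
  exact Measure.univ_pi_Ico_ae_eq_Icc

theorem measurableSet_halfOpenCell (n : Fin d → ℤ) : MeasurableSet (halfOpenCell n) := by
  rw [halfOpenCell_eq]
  exact MeasurableSet.univ_pi fun i => measurableSet_Ico

theorem isCompact_cell (n : Fin d → ℤ) : IsCompact (cell n) := isCompact_closedBall _ _

/-- The displacement `1/2` is at most `‖n‖ / 2`, since nonzero integer vectors have norm at least
`1`. -/
theorem half_norm_le_of_mem_cell {n : Fin d → ℤ} (hn : n ≠ 0) {x : Fin d → ℝ} (hx : x ∈ cell n) :
    ‖intVec n‖ / 2 ≤ ‖x‖ ∧ ‖x‖ ≤ 2 * ‖intVec n‖ := by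
  have h1 := one_le_norm_intVec hn
  have h2 : ‖x - intVec n‖ ≤ 1 / 2 := mem_closedBall_iff_norm.1 hx
  have h3 := norm_sub_norm_le (intVec n) x
  have h4 := norm_sub_norm_le x (intVec n)
  rw [norm_sub_rev] at h3
  constructor <;> linarith

theorem ne_zero_of_mem_cell {n : Fin d → ℤ} (hn : n ≠ 0) {x : Fin d → ℝ} (hx : x ∈ cell n) :
    x ≠ 0 := by
  rintro rfl
  have h1 := one_le_norm_intVec hn
  have h2 := (half_norm_le_of_mem_cell hn hx).1
  rw [norm_zero] at h2
  linarith

theorem volume_cell (n : Fin d → ℤ) : volume.real (cell n) = 1 := by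
  rw [cell, closedBall_eq_Icc _ (by norm_num), Measure.real, Real.volume_Icc_pi]
  simp
  norm_num

theorem integral_cell (n : Fin d → ℤ) (F : (Fin d → ℝ) → ℂ) :
    ∫ x in cell n, F x = ∫ y in Metric.closedBall 0 (1 / 2), F (intVec n + y) := by
  rw [← (measurePreserving_add_left (volume : Measure (Fin d → ℝ))
    (intVec n)).setIntegral_preimage_emb (MeasurableEquiv.addLeft _).measurableEmbedding]
  congr 2
  ext y
  simp [cell]

theorem integral_shell_eq_sum_cells {F : (Fin d → ℝ) → ℂ} (hF : ContinuousOn F {0}ᶜ) (N : ℕ) :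
    ∫ x in Metric.closedBall 0 ((N : ℝ) + 1 / 2) \ Metric.closedBall 0 (1 / 2), F x =
      ∑ n ∈ puncturedBox d N, ∫ x in cell n, F x := by
  have hico : ∀ M : ℕ, (Set.univ.pi fun _ : Fin d => Set.Ico (-(M : ℝ) - 1 / 2) ((M : ℝ) + 1 / 2))
      =ᵐ[volume] Metric.closedBall (0 : Fin d → ℝ) ((M : ℝ) + 1 / 2) := fun M => by
    rw [← cube_eq_closedBall]
    exact Measure.univ_pi_Ico_ae_eq_Icc
  have hmem : ∀ (M : ℕ) (x : Fin d → ℝ),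
      x ∈ (Set.univ.pi fun _ : Fin d => Set.Ico (-(M : ℝ) - 1 / 2) ((M : ℝ) + 1 / 2)) ↔
      (fun i => ⌊x i + 1 / 2⌋) ∈ Finset.Icc (fun _ : Fin d => -(M : ℤ)) (fun _ => (M : ℤ)) :=
    fun M x => by
      simp only [Set.mem_univ_pi, Set.mem_Ico, Finset.mem_Icc, Pi.le_def, ← forall_and]
      refine forall_congr' fun i => ?_
      rw [Int.le_floor, ← Int.lt_add_one_iff, Int.floor_lt]
      push_cast
      constructor <;> rintro ⟨h1, h2⟩ <;> constructor <;> linarith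
  -- Half-open cells partition the space exactly. The removed set is the box for `M = 0`, whose only
  -- cell is the central one.
  have hset : (⋃ n ∈ puncturedBox d N, halfOpenCell n) =
      (Set.univ.pi fun _ : Fin d => Set.Ico (-(N : ℝ) - 1 / 2) ((N : ℝ) + 1 / 2)) \
      (Set.univ.pi fun _ : Fin d => Set.Ico (-((0 : ℕ) : ℝ) - 1 / 2) (((0 : ℕ) : ℝ) + 1 / 2)) := by
    ext x
    rw [Set.mem_sdiff, hmem, hmem]
    simp only [Set.mem_iUnion, exists_prop, puncturedBox, Finset.mem_erase]
    have h0 : Finset.Icc (fun _ : Fin d => -((0 : ℕ) : ℤ)) (fun _ => ((0 : ℕ) : ℤ)) = {0} := by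
      have h : (fun _ : Fin d => -((0 : ℕ) : ℤ)) = 0 := by ext; simp
      rw [h]
      exact Finset.Icc_self (0 : Fin d → ℤ)
    rw [h0, Finset.mem_singleton]
    constructor
    · rintro ⟨n, ⟨h1, h2⟩, hx⟩
      have : (fun i => ⌊x i + 1 / 2⌋) = n := funext hx
      rw [this]
      exact ⟨h2, h1⟩
    · rintro ⟨h1, h2⟩
      exact ⟨_, ⟨h2, h1⟩, fun i => rfl⟩
  have hae : (⋃ n ∈ puncturedBox d N, halfOpenCell n) =ᵐ[volume]
      (Metric.closedBall 0 ((N : ℝ) + 1 / 2) \ Metric.closedBall 0 (1 / 2) : Set (Fin d → ℝ)) := by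
    rw [hset]
    have h0 := hico 0
    have h1 : ((0 : ℕ) : ℝ) + 1 / 2 = 1 / 2 := by simp
    rw [h1] at h0 ⊢
    exact ae_eq_set_sdiff (hico N) h0
  rw [← setIntegral_congr_set hae, integral_biUnion_finset _
    (fun n _ => measurableSet_halfOpenCell n)]
  · exact Finset.sum_congr rfl fun n _ => setIntegral_congr_set (halfOpenCell_ae_eq n)
  · intro m _ n _ hmn
    refine Set.disjoint_left.2 fun x hm hn => hmn (funext fun i => ?_)
    rw [← hm i, ← hn i]
  · intro n hn
    have hn0 : n ≠ 0 := (Finset.mem_erase.1 hn).1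
    rw [integrableOn_congr_set_ae (halfOpenCell_ae_eq n)]
    exact (hF.mono fun x hx => ne_zero_of_mem_cell hn0 hx).integrableOn_compact (isCompact_cell n)

theorem tendsto_sum_puncturedBox {f : (Fin d → ℤ) → ℂ} (hf : Summable f) (h0 : f 0 = 0) :
    Tendsto (fun N => ∑ n ∈ puncturedBox d N, f n) atTop (𝓝 (∑' n, f n)) := by
  have h1 : Tendsto (fun N : ℕ => Finset.Icc (fun _ : Fin d => -(N : ℤ)) (fun _ => (N : ℤ)))
      atTop atTop := by
    refine tendsto_atTop_finset_of_monotone (fun M N hMN => ?_) fun n => ?_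
    · refine Finset.Icc_subset_Icc ?_ ?_ <;> intro i <;> simpa using hMN
    · obtain ⟨M, hM⟩ := (Set.finite_range fun i => (n i).natAbs).bddAbove
      refine ⟨M, Finset.mem_Icc.2 ⟨fun i => ?_, fun i => ?_⟩⟩ <;>
      · have : (n i).natAbs ≤ M := hM ⟨i, rfl⟩
        simp only
        omega
  refine (hf.hasSum.comp h1).congr fun N => ?_
  exact (Finset.sum_erase _ h0).symm

/-! ### Moments of the unit cube -/

theorem integrableOn_unitCube {E : Type*} [NormedAddCommGroup E] {F : (Fin d → ℝ) → E}
    (hF : Continuous F) : IntegrableOn F (Metric.closedBall (0 : Fin d → ℝ) (1 / 2)) :=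
  hF.continuousOn.integrableOn_compact (isCompact_closedBall _ _)

theorem integral_unitCube_mul (i j : Fin d) :
    ∫ y in Metric.closedBall (0 : Fin d → ℝ) (1 / 2), y i * y j = if i = j then 1 / 12 else 0 := by
  have hpi : (Metric.closedBall (0 : Fin d → ℝ) (1 / 2)) =
      Set.univ.pi fun _ => Set.Icc (-(1 / 2) : ℝ) (1 / 2) := by
    rw [closedBall_eq_Icc _ (by norm_num), ← Set.pi_univ_Icc]
    simp
  let h : Fin d → ℝ → ℝ := fun k t => (if i = k then t else 1) * (if j = k then t else 1)
  have hprod : ∀ y : Fin d → ℝ, y i * y j = ∏ k, h k (y k) := fun y => by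
    simp only [h]
    rw [Finset.prod_mul_distrib]
    simp
  have h1 : ∫ t in Set.Icc (-(1 / 2) : ℝ) (1 / 2), (1 : ℝ) = 1 := by
    simp; norm_num
  have h2 : ∫ t in Set.Icc (-(1 / 2) : ℝ) (1 / 2), t = 0 := by
    rw [integral_Icc_eq_integral_Ioc, ← intervalIntegral.integral_of_le (by norm_num),
      integral_id]; norm_num
  have h3 : ∫ t in Set.Icc (-(1 / 2) : ℝ) (1 / 2), t * t = 1 / 12 := by
    rw [integral_Icc_eq_integral_Ioc, ← intervalIntegral.integral_of_le (by norm_num)]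
    simp only [← sq]
    rw [integral_pow]; norm_num
  simp only [hprod]
  rw [hpi, volume_pi, Measure.restrict_pi_pi, integral_fintype_prod_eq_prod]
  split_ifs with hij
  · subst hij
    rw [Finset.prod_eq_single i]
    · simpa [h] using h3
    · intro k _ hk
      simpa [h, hk.symm] using h1
    · simp
  · refine Finset.prod_eq_zero (Finset.mem_univ i) ?_
    have : j ≠ i := fun h => hij h.symm
    simpa [h, this] using h2

theorem integral_unitCube_quadForm (M : Matrix (Fin d) (Fin d) ℝ) :
    ∫ y in Metric.closedBall (0 : Fin d → ℝ) (1 / 2), quadForm M y = M.trace / 12 := by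
  simp only [quadForm_eq_sum]
  rw [integral_finsetSum _ fun i _ => integrableOn_unitCube (by fun_prop)]
  have : ∀ i, ∫ y in Metric.closedBall (0 : Fin d → ℝ) (1 / 2), ∑ j, M i j * (y i * y j) =
      M i i / 12 := fun i => by
    rw [integral_finsetSum _ fun j _ => integrableOn_unitCube (by fun_prop)]
    simp only [integral_const_mul, integral_unitCube_mul, mul_ite, mul_zero,
      Finset.sum_ite_eq, Finset.mem_univ, if_true]
    ring
  simp only [this, Matrix.trace, Matrix.diag, Finset.sum_div]

/-- The square is the quadratic form of the rank one matrix `v vᵀ`, whose trace is `v · v`. -/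
theorem integral_unitCube_dotProduct_sq (v : Fin d → ℝ) :
    ∫ y in Metric.closedBall (0 : Fin d → ℝ) (1 / 2), (dotProduct y v) ^ 2 =
      dotProduct v v / 12 := by
  have h : ∀ y : Fin d → ℝ, (dotProduct y v) ^ 2 = quadForm (Matrix.vecMulVec v v) y := fun y => by
    simp only [quadForm_eq_sum, sq, dotProduct, Finset.sum_mul_sum, Matrix.vecMulVec_apply]
    exact Finset.sum_congr rfl fun i _ => Finset.sum_congr rfl fun j _ => by ring
  simp only [h]
  rw [integral_unitCube_quadForm]
  simp only [Matrix.trace, Matrix.diag, Matrix.vecMulVec_apply, dotProduct]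

theorem integral_unitCube_dotProduct (v : Fin d → ℝ) :
    ∫ y in Metric.closedBall (0 : Fin d → ℝ) (1 / 2), dotProduct y v = 0 := by
  have h := (Measure.measurePreserving_neg
    (volume : Measure (Fin d → ℝ))).setIntegral_preimage_emb
    (MeasurableEquiv.neg _).measurableEmbedding (fun y => dotProduct y v)
    (Metric.closedBall (0 : Fin d → ℝ) (1 / 2))
  have h1 : Neg.neg ⁻¹' Metric.closedBall (0 : Fin d → ℝ) (1 / 2) =
      Metric.closedBall (0 : Fin d → ℝ) (1 / 2) := by ext y; simp
  simp only [h1, neg_dotProduct, integral_neg] at h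
  linarith

/-! ### Taylor estimates along segments -/

theorem norm_le_of_norm_deriv_le {f f' : ℝ → ℂ} {C : ℝ}
    (hf : ∀ t ∈ Set.Icc (0 : ℝ) 1, HasDerivAt f (f' t) t) (h0 : f 0 = 0)
    (hC : ∀ t ∈ Set.Icc (0 : ℝ) 1, ‖f' t‖ ≤ C) : ∀ t ∈ Set.Icc (0 : ℝ) 1, ‖f t‖ ≤ C := by
  intro t ht
  have h := norm_image_sub_le_of_norm_deriv_le_segment' (fun x hx => (hf x hx).hasDerivWithinAt)
    (fun x hx => hC x ⟨hx.1, hx.2.le⟩) t ht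
  have hC0 : 0 ≤ C := (norm_nonneg _).trans (hC 0 ⟨le_rfl, zero_le_one⟩)
  rw [h0, sub_zero, sub_zero] at h
  exact h.trans (mul_le_of_le_one_right hC0 ht.2)

/-- The mean value inequality is applied three times, and each integration over `[0, 1]` preserves
the bound `C`. The sharp factor `1/6` is not needed. -/
theorem norm_taylor_two_le {f f₁ f₂ f₃ : ℝ → ℂ} {C : ℝ}
    (h1 : ∀ t ∈ Set.Icc (0 : ℝ) 1, HasDerivAt f (f₁ t) t)
    (h2 : ∀ t ∈ Set.Icc (0 : ℝ) 1, HasDerivAt f₁ (f₂ t) t)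
    (h3 : ∀ t ∈ Set.Icc (0 : ℝ) 1, HasDerivAt f₂ (f₃ t) t)
    (hC : ∀ t ∈ Set.Icc (0 : ℝ) 1, ‖f₃ t‖ ≤ C) :
    ‖f 1 - f 0 - f₁ 0 - f₂ 0 / 2‖ ≤ C := by
  have hid : ∀ t : ℝ, HasDerivAt (fun t : ℝ => (t : ℂ)) 1 t := fun t => by
    simpa using (hasDerivAt_id t).ofReal_comp
  have e2 := norm_le_of_norm_deriv_le (f := fun t => f₂ t - f₂ 0)
    (fun t ht => (h3 t ht).sub_const _) (sub_self _) hC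
  have e1 := norm_le_of_norm_deriv_le (f := fun t => f₁ t - f₁ 0 - t * f₂ 0)
    (f' := fun t => f₂ t - f₂ 0) (fun t ht => by
      refine (((h2 t ht).sub_const (f₁ 0)).sub ((hid t).mul_const (f₂ 0))).congr_deriv ?_
      ring) (by simp) e2
  have e0 := norm_le_of_norm_deriv_le (f := fun t => f t - f 0 - t * f₁ 0 - t ^ 2 * (f₂ 0 / 2))
    (f' := fun t => f₁ t - f₁ 0 - t * f₂ 0) (fun t ht => by
      have := (((h1 t ht).sub_const (f 0)).sub ((hid t).mul_const (f₁ 0))).sub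
        (((hid t).pow 2).mul_const (f₂ 0 / 2))
      refine this.congr_deriv ?_
      push_cast
      ring) (by simp) e1 1 ⟨zero_le_one, le_rfl⟩
  simpa using e0

theorem hasDerivAt_ofReal_cpow {q : ℝ → ℝ} {q' t : ℝ} (hq : HasDerivAt q q' t) (h0 : 0 < q t)
    (e : ℂ) : HasDerivAt (fun t => (q t : ℂ) ^ e) (e * (q t : ℂ) ^ (e - 1) * q') t := by
  have h := ((hasDerivAt_id (q t : ℂ)).cpow_const (c := e)
    (Complex.ofReal_mem_slitPlane.2 h0)).comp t hq.ofReal_comp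
  refine h.congr_deriv ?_
  simp

/-- Second order expansion of a complex power of a real quadratic polynomial. -/
theorem norm_cpow_taylor_le {q r : ℝ → ℝ} {c R P₂ P₃ : ℝ} (s : ℂ)
    (hq : ∀ t, HasDerivAt q (r t) t) (hr : ∀ t, HasDerivAt r c t)
    (h0 : ∀ t ∈ Set.Icc (0 : ℝ) 1, 0 < q t) (hR : ∀ t ∈ Set.Icc (0 : ℝ) 1, |r t| ≤ R)
    (h2 : ∀ t ∈ Set.Icc (0 : ℝ) 1, ‖(q t : ℂ) ^ (-s - 2)‖ ≤ P₂)
    (h3 : ∀ t ∈ Set.Icc (0 : ℝ) 1, ‖(q t : ℂ) ^ (-s - 3)‖ ≤ P₃) :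
    ‖(q 1 : ℂ) ^ (-s) - (q 0 : ℂ) ^ (-s) - -s * (q 0 : ℂ) ^ (-s - 1) * r 0 -
      (-s * (q 0 : ℂ) ^ (-s - 1) * c + s * (s + 1) * (q 0 : ℂ) ^ (-s - 2) * (r 0) ^ 2) / 2‖ ≤
      3 * ‖s‖ * ‖s + 1‖ * R * |c| * P₂ + ‖s‖ * ‖s + 1‖ * ‖s + 2‖ * R ^ 3 * P₃ := by
  have hrC : ∀ t, HasDerivAt (fun t => (r t : ℂ)) c t := fun t => (hr t).ofReal_comp
  have e1 : -s - 1 - 1 = -s - 2 := by ring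
  have e2 : -s - 2 - 1 = -s - 3 := by ring
  refine norm_taylor_two_le (f := fun t => (q t : ℂ) ^ (-s))
    (f₁ := fun t => -s * (q t : ℂ) ^ (-s - 1) * r t)
    (f₂ := fun t => -s * (q t : ℂ) ^ (-s - 1) * c +
      s * (s + 1) * (q t : ℂ) ^ (-s - 2) * (r t) ^ 2)
    (f₃ := fun t => 3 * s * (s + 1) * r t * c * (q t : ℂ) ^ (-s - 2) -
      s * (s + 1) * (s + 2) * (r t) ^ 3 * (q t : ℂ) ^ (-s - 3))
    (fun t ht => hasDerivAt_ofReal_cpow (hq t) (h0 t ht) _) (fun t ht => ?_) (fun t ht => ?_)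
    (fun t ht => ?_)
  · have h := ((hasDerivAt_ofReal_cpow (hq t) (h0 t ht) (-s - 1)).const_mul (-s)).mul (hrC t)
    rw [e1] at h
    refine h.congr_deriv ?_
    ring
  · have h := (((hasDerivAt_ofReal_cpow (hq t) (h0 t ht) (-s - 1)).const_mul (-s)).mul_const
      (c : ℂ)).add (((hasDerivAt_ofReal_cpow (hq t) (h0 t ht) (-s - 2)).const_mul
        (s * (s + 1))).mul ((hrC t).pow 2))
    rw [e1, e2] at h
    refine h.congr_deriv ?_
    simp only [Pi.pow_apply]
    push_cast
    ring
  · have hRt := hR t ht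
    have hR0 : 0 ≤ R := (abs_nonneg _).trans hRt
    refine (norm_sub_le _ _).trans (add_le_add ?_ ?_)
    · simp only [norm_mul, Complex.norm_real, Real.norm_eq_abs, Complex.norm_ofNat]
      have := h2 t ht
      gcongr
    · simp only [norm_mul, norm_pow, Complex.norm_real, Real.norm_eq_abs]
      have := h3 t ht
      gcongr

/-- First order expansion of a product with a complex power. -/
theorem norm_mul_cpow_sub_le {q r : ℝ → ℝ} {N N' : ℝ → ℂ} {R P₂ P₃ S S' : ℝ} (s : ℂ)
    (hq : ∀ t, HasDerivAt q (r t) t) (hN : ∀ t, HasDerivAt N (N' t) t)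
    (h0 : ∀ t ∈ Set.Icc (0 : ℝ) 1, 0 < q t) (hR : ∀ t ∈ Set.Icc (0 : ℝ) 1, |r t| ≤ R)
    (hS : ∀ t ∈ Set.Icc (0 : ℝ) 1, ‖N t‖ ≤ S) (hS' : ∀ t ∈ Set.Icc (0 : ℝ) 1, ‖N' t‖ ≤ S')
    (h2 : ∀ t ∈ Set.Icc (0 : ℝ) 1, ‖(q t : ℂ) ^ (-s - 2)‖ ≤ P₂)
    (h3 : ∀ t ∈ Set.Icc (0 : ℝ) 1, ‖(q t : ℂ) ^ (-s - 3)‖ ≤ P₃) :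
    ‖N 1 * (q 1 : ℂ) ^ (-s - 2) - N 0 * (q 0 : ℂ) ^ (-s - 2)‖ ≤
      S' * P₂ + S * (‖s + 2‖ * P₃ * R) := by
  have e2 : -s - 2 - 1 = -s - 3 := by ring
  refine norm_le_of_norm_deriv_le
    (f := fun t => N t * (q t : ℂ) ^ (-s - 2) - N 0 * (q 0 : ℂ) ^ (-s - 2))
    (f' := fun t => N' t * (q t : ℂ) ^ (-s - 2) +
      N t * ((-s - 2) * (q t : ℂ) ^ (-s - 3) * r t)) (fun t ht => ?_) (sub_self _)
    (fun t ht => ?_) 1 ⟨zero_le_one, le_rfl⟩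
  · have h := ((hN t).mul (hasDerivAt_ofReal_cpow (hq t) (h0 t ht) (-s - 2))).sub_const
      (N 0 * (q 0 : ℂ) ^ (-s - 2))
    rwa [e2] at h
  · have hRt := hR t ht
    have b1 := hS t ht
    have b2 := hS' t ht
    have b3 := h2 t ht
    have b4 := h3 t ht
    have hS0 : 0 ≤ S := (norm_nonneg _).trans b1
    have hS0' : 0 ≤ S' := (norm_nonneg _).trans b2
    have hP0 : 0 ≤ P₃ := (norm_nonneg _).trans b4
    have e3 : ‖-s - 2‖ = ‖s + 2‖ := by rw [← norm_neg]; congr 1; ring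
    refine (norm_add_le _ _).trans (add_le_add ?_ ?_)
    · rw [norm_mul]
      gcongr
    · simp only [norm_mul, Complex.norm_real, Real.norm_eq_abs, e3]
      gcongr

/-! ### Quadratic forms along segments -/

theorem exists_bilinear_bound (M : Matrix (Fin d) (Fin d) ℝ) :
    ∃ E : ℝ, 0 ≤ E ∧ ∀ x y : Fin d → ℝ, |dotProduct x (M.mulVec y)| ≤ E * ‖x‖ * ‖y‖ := by
  refine ⟨∑ i, ∑ j, |M i j|, by positivity, fun x y => ?_⟩
  have h : dotProduct x (M.mulVec y) = ∑ i, ∑ j, M i j * (x i * y j) := by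
    simp only [dotProduct, Matrix.mulVec, Finset.mul_sum]
    exact Finset.sum_congr rfl fun i _ => Finset.sum_congr rfl fun j _ => by ring
  rw [h, mul_assoc, Finset.sum_mul]
  refine (Finset.abs_sum_le_sum_abs _ _).trans (Finset.sum_le_sum fun i _ => ?_)
  rw [Finset.sum_mul]
  refine (Finset.abs_sum_le_sum_abs _ _).trans (Finset.sum_le_sum fun j _ => ?_)
  rw [abs_mul, abs_mul]
  have h1 : |x i| ≤ ‖x‖ := norm_le_pi_norm x i
  have h2 : |y j| ≤ ‖y‖ := norm_le_pi_norm y j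
  gcongr

theorem quadForm_add_smul {M : Matrix (Fin d) (Fin d) ℝ} (hM : M.transpose = M)
    (v y : Fin d → ℝ) (t : ℝ) : quadForm M (v + t • y) =
      quadForm M v + 2 * dotProduct y (M.mulVec v) * t + quadForm M y * t ^ 2 := by
  have h : dotProduct v (M.mulVec y) = dotProduct y (M.mulVec v) := by
    rw [Matrix.dotProduct_mulVec, ← Matrix.mulVec_transpose, hM, dotProduct_comm]
  simp only [quadForm, Matrix.mulVec_add, Matrix.mulVec_smul, dotProduct_add, add_dotProduct,
    dotProduct_smul, smul_dotProduct, smul_eq_mul, h]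
  ring

theorem hasDerivAt_quadForm_segment {M : Matrix (Fin d) (Fin d) ℝ} (hM : M.transpose = M)
    (v y : Fin d → ℝ) (t : ℝ) : HasDerivAt (fun t : ℝ => quadForm M (v + t • y))
      (2 * dotProduct y (M.mulVec (v + t • y))) t := by
  simp only [quadForm_add_smul hM]
  have h := (((hasDerivAt_id t).const_mul (2 * dotProduct y (M.mulVec v))).const_add
    (quadForm M v)).add (((hasDerivAt_id t).pow 2).const_mul (quadForm M y))
  refine h.congr_deriv ?_
  simp only [quadForm, Matrix.mulVec_add, Matrix.mulVec_smul, dotProduct_add, dotProduct_smul,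
    smul_eq_mul, id]
  push_cast
  ring

theorem hasDerivAt_dotProduct_segment (M : Matrix (Fin d) (Fin d) ℝ)
    (v y : Fin d → ℝ) (t : ℝ) :
    HasDerivAt (fun t : ℝ => 2 * dotProduct y (M.mulVec (v + t • y))) (2 * quadForm M y) t := by
  simp only [Matrix.mulVec_add, Matrix.mulVec_smul, dotProduct_add, dotProduct_smul, smul_eq_mul]
  have h := (((hasDerivAt_id t).mul_const (dotProduct y (M.mulVec y))).const_add
    (dotProduct y (M.mulVec v))).const_mul 2
  refine h.congr_deriv ?_
  rw [quadForm]; ring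

/-! ### Comparison of lattice terms with cell averages -/

/-- The bounds share the factor `‖n‖^{-2 Re s - 3}`, the size of the final remainder, so that later
only integer powers of `‖n‖` have to cancel. -/
theorem exists_cell_cpow_bound (hA : A.PosDef) (M : ℝ) :
    ∃ C : ℝ, 0 ≤ C ∧ ∀ s : ℂ, ‖s‖ ≤ M → ∀ n : Fin d → ℤ, n ≠ 0 → ∀ x ∈ cell n,
      ‖((quadForm A x : ℝ) : ℂ) ^ (-s - 2)‖ ≤
        C * (‖intVec n‖ ^ (-2 * s.re - 3) / ‖intVec n‖) ∧
      ‖((quadForm A x : ℝ) : ℂ) ^ (-s - 3)‖ ≤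
        C * (‖intVec n‖ ^ (-2 * s.re - 3) / ‖intVec n‖ ^ 3) := by
  obtain ⟨K, hK1, hK⟩ := exists_quadForm_comparable hA
  have hK0 : 0 < K := by linarith
  have hL1 : 1 ≤ 4 * K := by linarith
  -- On a cell `‖x‖` is within a factor `2` of `m = ‖n‖`, so `Q(x)` is within a factor `4 K` of
  -- `m^2`. The real parts of the exponents are at most `M + 3` in absolute value.
  refine ⟨(4 * K) ^ (M + 3), by positivity, fun s hs n hn x hx => ?_⟩
  have hm := one_le_norm_intVec hn
  set m := ‖intVec n‖ with hmdef
  have hm0 : 0 < m := by linarith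
  obtain ⟨hx1, hx2⟩ := half_norm_le_of_mem_cell hn hx
  rw [← hmdef] at hx1 hx2
  have hlow : (4 * K)⁻¹ * m ^ 2 ≤ quadForm A x := by
    refine le_trans ?_ (hK x).1
    have : (m / 2) ^ 2 ≤ ‖x‖ ^ 2 := by gcongr
    rw [mul_inv, mul_comm (4 : ℝ)⁻¹, mul_assoc]
    gcongr
    linarith
  have hup : quadForm A x ≤ 4 * K * m ^ 2 := by
    refine (hK x).2.trans ?_
    have : ‖x‖ ^ 2 ≤ (2 * m) ^ 2 := by gcongr
    nlinarith
  have hre : |s.re| ≤ M := (Complex.abs_re_le_norm s).trans hs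
  have hgen : ∀ k : ℕ, (k : ℝ) ≤ 3 → ‖((quadForm A x : ℝ) : ℂ) ^ (-s - k)‖ ≤
      (4 * K) ^ (M + 3) * m ^ (-2 * s.re - 2 * k) := fun k hk => by
    refine (norm_ofReal_cpow_le hL1 (by positivity) hlow hup _).trans ?_
    have he : (-s - k).re = -s.re - k := by simp
    rw [he, ← Real.rpow_natCast m 2, ← Real.rpow_mul hm0.le]
    have h1 : (4 * K) ^ |-s.re - k| ≤ (4 * K) ^ (M + 3) := by
      refine Real.rpow_le_rpow_of_exponent_le hL1 ?_
      have h0 : (0 : ℝ) ≤ k := k.cast_nonneg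
      rw [abs_le] at hre ⊢
      constructor <;> linarith
    have h2 : ((2 : ℕ) : ℝ) * (-s.re - k) = -2 * s.re - 2 * k := by push_cast; ring
    rw [h2]
    gcongr
  constructor
  · have h := hgen 2 (by norm_num)
    refine (by simpa using h : _ ≤ _).trans_eq ?_
    congr 1
    rw [← Real.rpow_sub_one hm0.ne']
    congr 1; ring
  · have h := hgen 3 (by norm_num)
    refine (by simpa using h : _ ≤ _).trans_eq ?_
    congr 1
    rw [← Real.rpow_sub_natCast hm0.ne']
    congr 1; push_cast; ring

theorem segment_mem_cell (n : Fin d → ℤ) {y : Fin d → ℝ} (hy : ‖y‖ ≤ 1 / 2) {t : ℝ}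
    (ht : t ∈ Set.Icc (0 : ℝ) 1) : intVec n + t • y ∈ cell n := by
  rw [cell, mem_closedBall_iff_norm, add_sub_cancel_left, norm_smul, Real.norm_of_nonneg ht.1]
  exact (mul_le_of_le_one_left (norm_nonneg _) ht.2).trans hy

theorem integral_unitCube_const_mul_add (c₁ c₂ c₃ : ℂ) (v : Fin d → ℝ)
    (M : Matrix (Fin d) (Fin d) ℝ) :
    ∫ y in Metric.closedBall (0 : Fin d → ℝ) (1 / 2), (c₁ * (dotProduct y v : ℝ) +
      c₂ * (quadForm M y : ℝ) + c₃ * ((dotProduct y v ^ 2 : ℝ) : ℂ)) =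
      (c₂ * M.trace + c₃ * (dotProduct v v : ℝ)) / 12 := by
  have hc1 : Continuous fun y : Fin d → ℝ => dotProduct y v := by
    simp only [dotProduct]; fun_prop
  have hc2 := continuous_quadForm M
  rw [integral_add (integrableOn_unitCube (by fun_prop)) (integrableOn_unitCube (by fun_prop)),
    integral_add (integrableOn_unitCube (by fun_prop)) (integrableOn_unitCube (by fun_prop)),
    integral_const_mul, integral_const_mul, integral_const_mul, integral_complex_ofReal,
    integral_complex_ofReal, integral_complex_ofReal, integral_unitCube_dotProduct, integral_unitCube_quadForm,
    integral_unitCube_dotProduct_sq]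
  push_cast
  ring

theorem volume_unitCube :
    volume.real (Metric.closedBall (0 : Fin d → ℝ) (1 / 2)) = 1 := by
  have := volume_cell (0 : Fin d → ℤ)
  rwa [cell, intVec_eq_zero.2 rfl] at this

theorem norm_integral_unitCube_le {F : (Fin d → ℝ) → ℂ} {C : ℝ}
    (h : ∀ y : Fin d → ℝ, ‖y‖ ≤ 1 / 2 → ‖F y‖ ≤ C) :
    ‖∫ y in Metric.closedBall (0 : Fin d → ℝ) (1 / 2), F y‖ ≤ C := by
  have := norm_setIntegral_le_of_norm_le_const (μ := volume) (f := F)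
    (s := Metric.closedBall (0 : Fin d → ℝ) (1 / 2)) (C := C) measure_closedBall_lt_top
    fun y hy => h y (mem_closedBall_zero_iff.1 hy)
  rwa [volume_unitCube, mul_one] at this

theorem integral_unitCube_const (c : ℂ) :
    ∫ _ in Metric.closedBall (0 : Fin d → ℝ) (1 / 2), c = c := by
  rw [setIntegral_const, volume_unitCube, one_smul]

theorem continuousOn_cell_translate {F : (Fin d → ℝ) → ℂ} (hF : ContinuousOn F {0}ᶜ)
    {n : Fin d → ℤ} (hn : n ≠ 0) :
    ContinuousOn (fun y => F (intVec n + y)) (Metric.closedBall 0 (1 / 2)) := by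
  refine hF.comp (by fun_prop) fun y hy => ne_zero_of_mem_cell hn ?_
  simpa [cell] using hy

/-- The bounds used to compare values at a lattice point with averages over its cell. -/
theorem exists_segment_bounds (A : Matrix (Fin d) (Fin d) ℝ) : ∃ E : ℝ, 0 ≤ E ∧ |A.trace| ≤ E ∧
    (∀ n : Fin d → ℤ, n ≠ 0 → ∀ y : Fin d → ℝ, ‖y‖ ≤ 1 / 2 → |2 * quadForm A y| ≤ E ∧
      ∀ x ∈ cell n, |2 * dotProduct y (A.mulVec x)| ≤ E * ‖intVec n‖ ∧
        |2 * dotProduct y ((A ^ 2).mulVec x)| ≤ E * ‖intVec n‖) ∧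
    ∀ n : Fin d → ℤ, n ≠ 0 → ∀ x ∈ cell n, |quadForm A x| ≤ E * ‖intVec n‖ ^ 2 ∧
      |quadForm (A ^ 2) x| ≤ E * ‖intVec n‖ ^ 2 := by
  obtain ⟨E₁, hE₁, h₁⟩ := exists_bilinear_bound A
  obtain ⟨E₂, hE₂, h₂⟩ := exists_bilinear_bound (A ^ 2)
  refine ⟨4 * (E₁ + E₂) + |A.trace|, by positivity, by linarith, fun n hn y hy => ⟨?_, ?_⟩,
    fun n hn x hx => ?_⟩
  · have h := h₁ y y
    rw [abs_mul, abs_two]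
    have : E₁ * ‖y‖ * ‖y‖ ≤ E₁ * (1 / 2) * (1 / 2) := by gcongr
    have h0 := abs_nonneg A.trace
    rw [quadForm]
    linarith
  · intro x hx
    have hm := one_le_norm_intVec hn
    have hx2 := (half_norm_le_of_mem_cell hn hx).2
    have hT := mul_nonneg (abs_nonneg A.trace) (norm_nonneg (intVec n))
    have hgen : ∀ E : ℝ, 0 ≤ E → E * ‖y‖ * ‖x‖ ≤ E * (1 / 2) * (2 * ‖intVec n‖) :=
      fun E hE => by gcongr
    have g1 := hgen E₁ hE₁
    have g2 := hgen E₂ hE₂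
    have p1 := mul_nonneg hE₁ (norm_nonneg (intVec n))
    have p2 := mul_nonneg hE₂ (norm_nonneg (intVec n))
    rw [abs_mul, abs_mul, abs_two]
    constructor
    · have := h₁ y x
      nlinarith
    · have := h₂ y x
      nlinarith
  · have hx2 := (half_norm_le_of_mem_cell hn hx).2
    have hT := mul_nonneg (abs_nonneg A.trace) (sq_nonneg ‖intVec n‖)
    have hgen : ∀ E : ℝ, 0 ≤ E → E * ‖x‖ * ‖x‖ ≤ E * (2 * ‖intVec n‖) * (2 * ‖intVec n‖) :=
      fun E hE => by gcongr
    have g1 := hgen E₁ hE₁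
    have g2 := hgen E₂ hE₂
    have p1 := mul_nonneg hE₁ (sq_nonneg ‖intVec n‖)
    have p2 := mul_nonneg hE₂ (sq_nonneg ‖intVec n‖)
    constructor
    · have := h₁ x x
      rw [quadForm]
      nlinarith
    · have := h₂ x x
      rw [quadForm]
      nlinarith

theorem qLap_eq' (s : ℂ) (x : Fin d → ℝ) :
    qLap A s x = (A.trace * quadForm A x - 2 * (s + 1) * quadForm (A ^ 2) x) *
      ((quadForm A x : ℝ) : ℂ) ^ (-s - 2) := by
  rw [qLap_eq, show -(s + 2) = -s - 2 by ring]

/-- Used with `B = ‖n‖^2` for the numerator of `qLap` and with `B = ‖n‖` for its derivative along a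
segment. -/
theorem norm_laplace_coeff_le {E M a b t : ℝ} {s : ℂ} (hE : 0 ≤ E) (hs : ‖s‖ ≤ M)
    (ht : |t| ≤ E) {B : ℝ} (ha : |a| ≤ E * B) (hb : |b| ≤ E * B) :
    ‖(t : ℂ) * a - 2 * (s + 1) * b‖ ≤ (E ^ 2 + 2 * (M + 1) * E) * B := by
  have h1 : ‖s + 1‖ ≤ M + 1 := (norm_add_le _ _).trans (by simpa using hs)
  have hM : 0 ≤ M + 1 := (norm_nonneg _).trans h1
  refine (norm_sub_le _ _).trans ?_
  simp only [norm_mul, Complex.norm_real, Real.norm_eq_abs, Complex.norm_ofNat]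
  calc |t| * |a| + 2 * ‖s + 1‖ * |b| ≤ E * (E * B) + 2 * (M + 1) * (E * B) := by gcongr
    _ = _ := by ring

/-- Bounds for cell averages of `qLap`. -/
theorem exists_qLap_cell_bound (hA : A.PosDef) {M : ℝ} (hM : 0 ≤ M) :
    ∃ C : ℝ, 0 ≤ C ∧ ∀ s : ℂ, ‖s‖ ≤ M → ∀ n : Fin d → ℤ, n ≠ 0 →
      ‖∫ x in cell n, qLap A s x‖ ≤ C * ‖intVec n‖ ^ (-2 * s.re - 2) := by
  obtain ⟨C, hC0, hC⟩ := exists_cell_cpow_bound hA M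
  obtain ⟨E, hE0, hEt, -, hE⟩ := exists_segment_bounds A
  refine ⟨(E ^ 2 + 2 * (M + 1) * E) * C, by positivity, fun s hs n hn => ?_⟩
  have hm := one_le_norm_intVec hn
  set m := ‖intVec n‖ with hmdef
  have hm0 : 0 < m := by linarith
  rw [integral_cell]
  refine norm_integral_unitCube_le fun y hy => ?_
  have hx : intVec n + y ∈ cell n := by
    simpa using segment_mem_cell n hy (t := 1) ⟨zero_le_one, le_rfl⟩
  rw [qLap_eq', norm_mul]
  have h1 := norm_laplace_coeff_le hE0 hs hEt (hE n hn _ hx).1 (hE n hn _ hx).2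
  have h2 := (hC s hs n hn _ hx).1
  rw [← hmdef] at h1 h2
  calc _ ≤ ((E ^ 2 + 2 * (M + 1) * E) * m ^ 2) * (C * (m ^ (-2 * s.re - 3) / m)) := by gcongr
    _ = (E ^ 2 + 2 * (M + 1) * E) * C * (m ^ (-2 * s.re - 3) * m) := by field_simp
    _ = _ := by
      rw [← Real.rpow_add_one hm0.ne']
      congr 2; ring

/-- This allows the point value of `qLap` in the midpoint rule to be replaced by its cell average,
so that the second order terms add up to a shell integral. -/
theorem exists_qLap_sub_average_bound (hA : A.PosDef) {M : ℝ} (hM : 0 ≤ M) :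
    ∃ C : ℝ, 0 ≤ C ∧ ∀ s : ℂ, ‖s‖ ≤ M → ∀ n : Fin d → ℤ, n ≠ 0 →
      ‖(∫ x in cell n, qLap A s x) - qLap A s (intVec n)‖ ≤
        C * ‖intVec n‖ ^ (-2 * s.re - 3) := by
  obtain ⟨C, hC0, hC⟩ := exists_cell_cpow_bound hA M
  obtain ⟨E, hE0, hEt, hE1, hE2⟩ := exists_segment_bounds A
  have hsym : A.transpose = A := show A.IsSymm by simpa using hA.isHermitian
  have hsym2 : (A ^ 2).transpose = A ^ 2 := by rw [Matrix.transpose_pow, hsym]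
  set D := E ^ 2 + 2 * (M + 1) * E with hD
  have hD0 : 0 ≤ D := by positivity
  refine ⟨D * C + D * ((M + 2) * C * E), by positivity, fun s hs n hn => ?_⟩
  have hm := one_le_norm_intVec hn
  set m := ‖intVec n‖ with hmdef
  have hm0 : 0 < m := by linarith
  rw [integral_cell, ← integral_unitCube_const (d := d) (qLap A s (intVec n)), ← integral_sub]
  rotate_left
  · exact (continuousOn_cell_translate (isHomogeneousFun_qLap hA s).continuousOn
      hn).integrableOn_compact (isCompact_closedBall _ _)
  · exact integrableOn_unitCube continuous_const
  refine norm_integral_unitCube_le fun y hy => ?_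
  have hseg : ∀ t ∈ Set.Icc (0 : ℝ) 1, intVec n + t • y ∈ cell n :=
    fun t ht => segment_mem_cell n hy ht
  have h := norm_mul_cpow_sub_le (q := fun t => quadForm A (intVec n + t • y))
    (N := fun t => (A.trace * quadForm A (intVec n + t • y) -
      2 * (s + 1) * quadForm (A ^ 2) (intVec n + t • y) : ℂ))
    (N' := fun t => (A.trace * (2 * dotProduct y (A.mulVec (intVec n + t • y)) : ℝ) -
      2 * (s + 1) * (2 * dotProduct y ((A ^ 2).mulVec (intVec n + t • y)) : ℝ) : ℂ))
    (R := E * m) (S := D * m ^ 2) (S' := D * m)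
    (P₂ := C * (m ^ (-2 * s.re - 3) / m)) (P₃ := C * (m ^ (-2 * s.re - 3) / m ^ 3)) s
    (fun t => hasDerivAt_quadForm_segment hsym _ _ t)
    (fun t => ((hasDerivAt_quadForm_segment hsym _ _ t).ofReal_comp.const_mul _).sub
      ((hasDerivAt_quadForm_segment hsym2 _ _ t).ofReal_comp.const_mul _))
    (fun t ht => quadForm_pos hA (ne_zero_of_mem_cell hn (hseg t ht)))
    (fun t ht => ((hE1 n hn y hy).2 _ (hseg t ht)).1)
    (fun t ht => norm_laplace_coeff_le hE0 hs hEt (hE2 n hn _ (hseg t ht)).1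
      (hE2 n hn _ (hseg t ht)).2)
    (fun t ht => norm_laplace_coeff_le hE0 hs hEt ((hE1 n hn y hy).2 _ (hseg t ht)).1
      ((hE1 n hn y hy).2 _ (hseg t ht)).2)
    (fun t ht => (hC s hs n hn _ (hseg t ht)).1) (fun t ht => (hC s hs n hn _ (hseg t ht)).2)
  simp only [one_smul, zero_smul, add_zero, ← qLap_eq'] at h
  have hs2 : ‖s + 2‖ ≤ M + 2 := (norm_add_le _ _).trans (by simpa using hs)
  refine h.trans ?_
  have hT : 0 < m ^ (-2 * s.re - 3) := by positivity
  calc D * m * (C * (m ^ (-2 * s.re - 3) / m)) +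
        D * m ^ 2 * (‖s + 2‖ * (C * (m ^ (-2 * s.re - 3) / m ^ 3)) * (E * m))
      ≤ D * m * (C * (m ^ (-2 * s.re - 3) / m)) +
        D * m ^ 2 * ((M + 2) * (C * (m ^ (-2 * s.re - 3) / m ^ 3)) * (E * m)) := by gcongr
    _ = _ := by field_simp

/-- The second order midpoint rule for `Q^{-s}` on a cell. -/
theorem exists_qPow_midpoint_bound (hA : A.PosDef) {M : ℝ} (hM : 0 ≤ M) :
    ∃ C : ℝ, 0 ≤ C ∧ ∀ s : ℂ, ‖s‖ ≤ M → ∀ n : Fin d → ℤ, n ≠ 0 →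
      ‖(∫ x in cell n, qPow A s x) - qPow A s (intVec n) + s / 12 * qLap A s (intVec n)‖ ≤
        C * ‖intVec n‖ ^ (-2 * s.re - 3) := by
  obtain ⟨C, hC0, hC⟩ := exists_cell_cpow_bound hA M
  obtain ⟨E, hE0, hEt, hE1, hE2⟩ := exists_segment_bounds A
  have hsym : A.transpose = A := show A.IsSymm by simpa using hA.isHermitian
  refine ⟨3 * M * (M + 1) * E * E * C + M * (M + 1) * (M + 2) * E ^ 3 * C, by positivity,
    fun s hs n hn => ?_⟩
  have hm := one_le_norm_intVec hn
  set m := ‖intVec n‖ with hmdef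
  have hm0 : 0 < m := by linarith
  set v := A.mulVec (intVec n) with hv
  set q₀ := quadForm A (intVec n) with hq₀
  have hq₀0 : (q₀ : ℂ) ≠ 0 := by
    exact_mod_cast (quadForm_pos hA fun h0 => hn (intVec_eq_zero.1 h0)).ne'
  have hvv : dotProduct v v = quadForm (A ^ 2) (intVec n) := by
    rw [quadForm, sq, ← Matrix.mulVec_mulVec, Matrix.dotProduct_mulVec (intVec n), hv]
    congr 1
    rw [← Matrix.mulVec_transpose, hsym]
  -- The integrand consists of the first and second order Taylor terms of `Q^{-s}` at `n`. The
  -- linear one is odd, and the second moments `1/12` of the unit cube turn the rest into `-s/12`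
  -- times `qLap`.
  have hmain : s / 12 * qLap A s (intVec n) =
      -∫ y in Metric.closedBall (0 : Fin d → ℝ) (1 / 2),
        (-s * (q₀ : ℂ) ^ (-s - 1) * 2 * (dotProduct y v : ℝ) +
        -s * (q₀ : ℂ) ^ (-s - 1) * (quadForm A y : ℝ) +
        2 * s * (s + 1) * (q₀ : ℂ) ^ (-s - 2) * ((dotProduct y v ^ 2 : ℝ) : ℂ)) := by
    rw [integral_unitCube_const_mul_add, hvv, qLap_eq', ← hq₀]
    have : (q₀ : ℂ) ^ (-s - 1) = q₀ * (q₀ : ℂ) ^ (-s - 2) := by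
      rw [show -s - 1 = 1 + (-s - 2) by ring, Complex.cpow_add _ _ hq₀0, Complex.cpow_one]
    rw [this]
    ring
  have hcv : Continuous fun y : Fin d → ℝ => dotProduct y v := by
    simp only [dotProduct]; fun_prop
  have hcA := continuous_quadForm A
  rw [hmain, ← sub_eq_add_neg, integral_cell,
    ← integral_unitCube_const (d := d) (qPow A s (intVec n)), ← integral_sub, ← integral_sub]
  rotate_left
  · refine Integrable.sub ?_ (integrableOn_unitCube continuous_const)
    exact (continuousOn_cell_translate (isHomogeneousFun_qPow hA s).continuousOn
      hn).integrableOn_compact (isCompact_closedBall _ _)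
  · exact integrableOn_unitCube (by fun_prop)
  · exact (continuousOn_cell_translate (isHomogeneousFun_qPow hA s).continuousOn
      hn).integrableOn_compact (isCompact_closedBall _ _)
  · exact integrableOn_unitCube continuous_const
  refine norm_integral_unitCube_le fun y hy => ?_
  have hseg : ∀ t ∈ Set.Icc (0 : ℝ) 1, intVec n + t • y ∈ cell n :=
    fun t ht => segment_mem_cell n hy ht
  have h := norm_cpow_taylor_le (q := fun t => quadForm A (intVec n + t • y))
    (R := E * m) (P₂ := C * (m ^ (-2 * s.re - 3) / m)) (P₃ := C * (m ^ (-2 * s.re - 3) / m ^ 3)) s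
    (fun t => hasDerivAt_quadForm_segment hsym _ _ t)
    (fun t => hasDerivAt_dotProduct_segment A _ _ t)
    (fun t ht => quadForm_pos hA (ne_zero_of_mem_cell hn (hseg t ht)))
    (fun t ht => ((hE1 n hn y hy).2 _ (hseg t ht)).1)
    (fun t ht => (hC s hs n hn _ (hseg t ht)).1) (fun t ht => (hC s hs n hn _ (hseg t ht)).2)
  simp only [one_smul, zero_smul, add_zero, ← qPow_eq, ← hv, ← hq₀] at h
  have hs1 : ‖s + 1‖ ≤ M + 1 := (norm_add_le _ _).trans (by simpa using hs)
  have hs2 : ‖s + 2‖ ≤ M + 2 := (norm_add_le _ _).trans (by simpa using hs)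
  have hc := (hE1 n hn y hy).1
  have hT : 0 < m ^ (-2 * s.re - 3) := by positivity
  calc _ = _ := by
        congr 1
        rw [qPow_eq s (intVec n), ← hq₀]
        push_cast
        ring
    _ ≤ _ := h
    _ ≤ 3 * M * (M + 1) * (E * m) * E * (C * (m ^ (-2 * s.re - 3) / m)) +
        M * (M + 1) * (M + 2) * (E * m) ^ 3 * (C * (m ^ (-2 * s.re - 3) / m ^ 3)) := by gcongr
    _ = _ := by field_simp

/-! ### The regularised lattice sums -/

/-- The difference between `Q(n)^{-s}` and its average over the cell of `n ≠ 0`. -/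
def cellDefect (A : Matrix (Fin d) (Fin d) ℝ) (n : Fin d → ℤ) (s : ℂ) : ℂ :=
  if n = 0 then 0 else qPow A s (intVec n) - ∫ x in cell n, qPow A s x

/-- The cell defect without its second order term. -/
def cellRemainder (A : Matrix (Fin d) (Fin d) ℝ) (n : Fin d → ℤ) (s : ℂ) : ℂ :=
  if n = 0 then 0 else cellDefect A n s - s / 12 * ∫ x in cell n, qLap A s x

/-- `∫ Q^{-s}` over the central unit cube, as a meromorphic function of `s`. -/
def centralIntegral (A : Matrix (Fin d) (Fin d) ℝ) (s : ℂ) : ℂ :=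
  ((1 / 2 : ℝ) : ℂ) ^ ((d : ℂ) - 2 * s) / ((d : ℂ) - 2 * s) * bdryPow A s

theorem differentiable_cellDefect (hA : A.PosDef) (n : Fin d → ℤ) :
    Differentiable ℂ (cellDefect A n) := by
  unfold cellDefect
  split_ifs with hn
  · exact differentiable_const 0
  · refine Differentiable.sub ?_ (differentiable_integral_qPow hA (isCompact_cell n)
      continuousOn_id fun x hx => ne_zero_of_mem_cell hn hx)
    simp only [qPow_eq]
    have h0 : ((quadForm A (intVec n) : ℝ) : ℂ) ≠ 0 := by
      exact_mod_cast (quadForm_pos hA fun h0 => hn (intVec_eq_zero.1 h0)).ne'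
    exact fun s => (differentiableAt_id.neg).const_cpow (Or.inl h0)

theorem differentiable_cellRemainder (hA : A.PosDef) (n : Fin d → ℤ) :
    Differentiable ℂ (cellRemainder A n) := by
  unfold cellRemainder
  split_ifs with hn
  · exact differentiable_const 0
  · refine (differentiable_cellDefect hA n).sub (Differentiable.mul (by fun_prop) ?_)
    exact differentiable_integral_qLap hA (isCompact_cell n) continuousOn_id
      fun x hx => ne_zero_of_mem_cell hn hx

/-- The extra power of `‖n‖` moves the region of summability from `Re s > d/2 - 1` to `Re s > (d -
3)/2`, which contains the critical point. -/
theorem exists_cellRemainder_bound (hA : A.PosDef) {M : ℝ} (hM : 0 ≤ M) :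
    ∃ C : ℝ, 0 ≤ C ∧ ∀ s : ℂ, ‖s‖ ≤ M → ∀ n : Fin d → ℤ,
      ‖cellRemainder A n s‖ ≤ C * ‖intVec n‖ ^ (-2 * s.re - 3) := by
  obtain ⟨C₁, hC₁, h₁⟩ := exists_qPow_midpoint_bound hA hM
  obtain ⟨C₂, hC₂, h₂⟩ := exists_qLap_sub_average_bound hA hM
  refine ⟨C₁ + M / 12 * C₂, by positivity, fun s hs n => ?_⟩
  unfold cellRemainder cellDefect
  split_ifs with hn
  · rw [norm_zero]; positivity
  · have e : qPow A s (intVec n) - (∫ x in cell n, qPow A s x) -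
        s / 12 * ∫ x in cell n, qLap A s x =
        -((∫ x in cell n, qPow A s x) - qPow A s (intVec n) + s / 12 * qLap A s (intVec n)) -
        s / 12 * ((∫ x in cell n, qLap A s x) - qLap A s (intVec n)) := by ring
    rw [e, add_mul]
    refine (norm_sub_le _ _).trans (add_le_add ?_ ?_)
    · rw [norm_neg]; exact h₁ s hs n hn
    · rw [norm_mul, mul_assoc]
      have : ‖s / 12‖ ≤ M / 12 := by
        rw [norm_div, Complex.norm_ofNat]; gcongr
      have := h₂ s hs n hn
      gcongr

theorem exists_cellDefect_bound (hA : A.PosDef) {M : ℝ} (hM : 0 ≤ M) :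
    ∃ C : ℝ, 0 ≤ C ∧ ∀ s : ℂ, ‖s‖ ≤ M → ∀ n : Fin d → ℤ,
      ‖cellDefect A n s‖ ≤ C * ‖intVec n‖ ^ (-2 * s.re - 2) := by
  obtain ⟨C₁, hC₁, h₁⟩ := exists_cellRemainder_bound hA hM
  obtain ⟨C₂, hC₂, h₂⟩ := exists_qLap_cell_bound hA hM
  refine ⟨C₁ + M / 12 * C₂, by positivity, fun s hs n => ?_⟩
  rcases eq_or_ne n 0 with rfl | hn
  · rw [cellDefect, if_pos rfl, norm_zero]; positivity
  · have e : cellDefect A n s = cellRemainder A n s + s / 12 * ∫ x in cell n, qLap A s x := by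
      rw [cellRemainder, if_neg hn]; ring
    rw [e, add_mul]
    refine (norm_add_le _ _).trans (add_le_add ?_ ?_)
    · refine (h₁ s hs n).trans (mul_le_mul_of_nonneg_left ?_ hC₁)
      exact Real.rpow_le_rpow_of_exponent_le (one_le_norm_intVec hn) (by linarith)
    · rw [norm_mul, mul_assoc]
      have : ‖s / 12‖ ≤ M / 12 := by
        rw [norm_div, Complex.norm_ofNat]; gcongr
      have := h₂ s hs n hn
      gcongr

/-- Locally uniform summability, on a half plane, of a family of entire functions. -/
theorem summable_and_differentiableAt_tsum {F : (Fin d → ℤ) → ℂ → ℂ} {k : ℝ}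
    (hF : ∀ n, Differentiable ℂ (F n)) (h0 : ∀ s, F 0 s = 0)
    (hb : ∀ M : ℝ, 0 ≤ M → ∃ C : ℝ, 0 ≤ C ∧ ∀ s : ℂ, ‖s‖ ≤ M → ∀ n : Fin d → ℤ,
      ‖F n s‖ ≤ C * ‖intVec n‖ ^ (-2 * s.re - k)) {s : ℂ} (hs : ((d : ℝ) - k) / 2 < s.re) :
    Summable (fun n => F n s) ∧ DifferentiableAt ℂ (fun s => ∑' n, F n s) s := by
  -- With `c` strictly between, `-2 c - k < -d`, so one summable majorant serves a whole
  -- neighbourhood of `s`.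
  obtain ⟨c, hc1, hc2⟩ := exists_between hs
  obtain ⟨C, hC0, hC⟩ := hb (‖s‖ + 1) (by positivity)
  have hsum : Summable fun n : Fin d → ℤ => C * ‖intVec n‖ ^ (-2 * c - k) :=
    (summable_norm_intVec_rpow (by linarith)).mul_left C
  have hle : ∀ (n : Fin d → ℤ) (w : ℂ), w ∈ Metric.ball 0 (‖s‖ + 1) ∩ {w : ℂ | c < w.re} →
      ‖F n w‖ ≤ C * ‖intVec n‖ ^ (-2 * c - k) := fun n w hw => by
    rcases eq_or_ne n 0 with rfl | hn
    · rw [h0, norm_zero]; positivity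
    · refine (hC w (mem_ball_zero_iff.1 hw.1).le n).trans (mul_le_mul_of_nonneg_left ?_ hC0)
      have hw2 : c < w.re := hw.2
      exact Real.rpow_le_rpow_of_exponent_le (one_le_norm_intVec hn) (by linarith)
  have hopen : IsOpen (Metric.ball 0 (‖s‖ + 1) ∩ {w : ℂ | c < w.re}) :=
    Metric.isOpen_ball.inter (isOpen_lt continuous_const Complex.continuous_re)
  have hmem : s ∈ Metric.ball 0 (‖s‖ + 1) ∩ {w : ℂ | c < w.re} :=
    ⟨mem_ball_zero_iff.2 (by linarith), hc2⟩
  refine ⟨Summable.of_norm_bounded hsum fun n => hle n s hmem, ?_⟩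
  exact (Complex.differentiableOn_tsum_of_summable_norm hsum
    (fun n => (hF n).differentiableOn) hopen hle).differentiableAt (hopen.mem_nhds hmem)

/-- The cells other than the central one fill a shell. No integrability at the origin is involved,
so the identity is available on both sides of `Re s = d/2`. -/
theorem cellDefect_sum (hA : A.PosDef) {s : ℂ} (hs : s ≠ (d : ℂ) / 2) (N : ℕ) :
    ∑ n ∈ puncturedBox d N, cellDefect A n s = alphaN A N s -
      ((((N : ℝ) + 1 / 2 : ℝ) : ℂ) ^ ((d : ℂ) - 2 * s) / ((d : ℂ) - 2 * s) * bdryPow A s) +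
      centralIntegral A s := by
  have h1 : ∑ n ∈ puncturedBox d N, cellDefect A n s =
      alphaN A N s - ∑ n ∈ puncturedBox d N, ∫ x in cell n, qPow A s x := by
    rw [alphaN, ← puncturedBox, ← Finset.sum_sub_distrib]
    refine Finset.sum_congr rfl fun n hn => ?_
    rw [cellDefect, if_neg (Finset.mem_erase.1 hn).1]
    rfl
  rw [h1, ← integral_shell_eq_sum_cells (isHomogeneousFun_qPow hA s).continuousOn,
    integral_shell_qPow hA hs (by norm_num) (by linarith [Nat.cast_nonneg (α := ℝ) N]),
    centralIntegral]
  ring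

/-- The cell averages of `qLap` assemble into a shell integral, which factors into a radial integral
and `V`. -/
theorem cellDefect_sum_eq_remainder (hA : A.PosDef) (s : ℂ) (N : ℕ) :
    ∑ n ∈ puncturedBox d N, cellDefect A n s = ∑ n ∈ puncturedBox d N, cellRemainder A n s +
      s / 12 * ((∫ r in (1 / 2 : ℝ)..((N : ℝ) + 1 / 2), (r : ℂ) ^ ((d : ℂ) - 3 - 2 * s)) *
        V A s) := by
  rw [← integral_shell_qLap hA s (by norm_num) (by linarith [Nat.cast_nonneg (α := ℝ) N]),
    integral_shell_eq_sum_cells (isHomogeneousFun_qLap hA s).continuousOn, Finset.mul_sum,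
    ← Finset.sum_add_distrib]
  refine Finset.sum_congr rfl fun n hn => ?_
  rw [cellRemainder, if_neg (Finset.mem_erase.1 hn).1]
  ring

/-- For `Re s < d/2` the outer boundary term in `cellDefect_sum` is exactly `betaN`. -/
theorem sigmaN_eq (hd : 1 ≤ d) (hA : A.PosDef) {s : ℂ} (hs : s.re < (d : ℝ) / 2) (N : ℕ) :
    sigmaN A N s = ∑ n ∈ puncturedBox d N, cellDefect A n s - centralIntegral A s := by
  have hs' : s ≠ (d : ℂ) / 2 := fun h => by
    rw [h, show ((d : ℂ) / 2) = (((d : ℝ) / 2 : ℝ) : ℂ) by push_cast; rfl, Complex.ofReal_re] at hs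
    exact lt_irrefl _ hs
  rw [cellDefect_sum hA hs', sigmaN, betaN_eq hd hA hs]
  ring

theorem tendsto_natCast_add_half_cpow {z : ℂ} (hz : z.re < 0) :
    Tendsto (fun N : ℕ => (((N : ℝ) + 1 / 2 : ℝ) : ℂ) ^ z) atTop (𝓝 0) := by
  rw [tendsto_zero_iff_norm_tendsto_zero]
  have h1 : ∀ N : ℕ, ‖(((N : ℝ) + 1 / 2 : ℝ) : ℂ) ^ z‖ = ((N : ℝ) + 1 / 2) ^ z.re :=
    fun N => Complex.norm_cpow_eq_rpow_re_of_pos (by positivity) _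
  simp only [h1]
  have h2 := tendsto_rpow_neg_atTop (y := -z.re) (by linarith)
  rw [neg_neg] at h2
  exact h2.comp (tendsto_atTop_add_const_right _ _ tendsto_natCast_atTop_atTop)

/-! ### Identification with the Epstein zeta function -/

theorem cellDefect_zero (s : ℂ) : cellDefect A 0 s = 0 := if_pos rfl

theorem cellRemainder_zero (s : ℂ) : cellRemainder A 0 s = 0 := if_pos rfl

/-- Here the lattice sum converges by itself, and the outer boundary term `(N + 1/2)^{d-2s}` tends
to `0`. -/
theorem tsum_cellDefect_of_gt (hA : A.PosDef) {Z : ℂ → ℂ} (hZ : IsEpsteinZeta A Z) {s : ℂ}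
    (hs : (d : ℝ) / 2 < s.re) :
    ∑' n, cellDefect A n s = Z s + centralIntegral A s := by
  have hs' : s ≠ (d : ℂ) / 2 := fun h => by
    rw [h, show ((d : ℂ) / 2) = (((d : ℝ) / 2 : ℝ) : ℂ) by push_cast; rfl, Complex.ofReal_re] at hs
    exact lt_irrefl _ hs
  have hsum := (summable_and_differentiableAt_tsum (k := 2) (differentiable_cellDefect hA)
    cellDefect_zero (fun M hM => exists_cellDefect_bound hA hM) (s := s) (by linarith)).1
  refine tendsto_nhds_unique (tendsto_sum_puncturedBox hsum (cellDefect_zero s)) ?_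
  simp only [cellDefect_sum hA hs']
  refine Tendsto.add ?_ tendsto_const_nhds
  have hα : Tendsto (fun N => alphaN A N s) atTop (𝓝 (Z s)) := by
    have h1 := (hasSum_subtype_iff_indicator (s := {n : Fin d → ℤ | n ≠ 0})
      (f := fun n => 1 / ((quadFormInt A n : ℝ) : ℂ) ^ s)).1 (hZ.hasSum s hs)
    have h2 := tendsto_sum_puncturedBox h1.summable (by simp)
    rw [h1.tsum_eq] at h2
    refine h2.congr fun N => ?_
    rw [alphaN, ← puncturedBox]
    refine Finset.sum_congr rfl fun n hn => ?_
    rw [Set.indicator_of_mem (show n ∈ {n : Fin d → ℤ | n ≠ 0} from (Finset.mem_erase.1 hn).1)]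
  have h3 : Tendsto (fun N : ℕ => (((N : ℝ) + 1 / 2 : ℝ) : ℂ) ^ ((d : ℂ) - 2 * s)
      / ((d : ℂ) - 2 * s) * bdryPow A s) atTop (𝓝 0) := by
    have := ((tendsto_natCast_add_half_cpow (z := (d : ℂ) - 2 * s)
      (by simp; linarith)).div_const ((d : ℂ) - 2 * s)).mul_const (bdryPow A s)
    simpa using this
  simpa using hα.sub h3

theorem differentiableAt_centralIntegral (hA : A.PosDef) {s : ℂ} (hs : s ≠ (d : ℂ) / 2) :
    DifferentiableAt ℂ (centralIntegral A) s := by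
  have h0 : (d : ℂ) - 2 * s ≠ 0 := fun h => hs (by linear_combination (-1 / 2 : ℂ) * h)
  have h1 : DifferentiableAt ℂ (fun s : ℂ => (d : ℂ) - 2 * s) s := by fun_prop
  refine ((h1.const_cpow (Or.inl ?_)).div h1 h0).mul (differentiable_bdryPow hA s)
  norm_num

/-- By analytic continuation, the regularised sum represents the zeta function in the strip. -/
theorem tsum_cellDefect_of_strip (hA : A.PosDef) {Z : ℂ → ℂ} (hZ : IsEpsteinZeta A Z) {s : ℂ}
    (h1 : (d : ℝ) / 2 - 1 < s.re) (h2 : s.re < (d : ℝ) / 2) :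
    ∑' n, cellDefect A n s = Z s + centralIntegral A s := by
  -- The half plane and the strip are separated by the line through the pole `d/2`. The quadrant
  -- `S₂` crosses that line above the pole and meets both, so the union of the three convex sets is
  -- connected and avoids `d/2`.
  let S₁ : Set ℂ := {s | (d : ℝ) / 2 < s.re}
  let S₂ : Set ℂ := {s | (d : ℝ) / 2 - 1 < s.re} ∩ {s | 0 < s.im}
  let S₃ : Set ℂ := {s | (d : ℝ) / 2 - 1 < s.re} ∩ {s | s.re < (d : ℝ) / 2}
  have ho : IsOpen (S₁ ∪ S₂ ∪ S₃) := by
    have hre := Complex.continuous_re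
    have him := Complex.continuous_im
    exact ((isOpen_lt continuous_const hre).union ((isOpen_lt continuous_const hre).inter
      (isOpen_lt continuous_const him))).union
      ((isOpen_lt continuous_const hre).inter (isOpen_lt hre continuous_const))
  have hpre : IsPreconnected (S₁ ∪ S₂ ∪ S₃) := by
    have c₁ : IsPreconnected S₁ := (convex_halfSpace_re_gt _).isPreconnected
    have c₂ : IsPreconnected S₂ :=
      ((convex_halfSpace_re_gt _).inter (convex_halfSpace_im_gt _)).isPreconnected
    have c₃ : IsPreconnected S₃ :=
      ((convex_halfSpace_re_gt _).inter (convex_halfSpace_re_lt _)).isPreconnected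
    refine (c₁.union ⟨(d : ℝ) / 2 + 1, 1⟩ ?_ ?_ c₂).union ⟨(d : ℝ) / 2 - 1 / 2, 1⟩
      (Or.inr ?_) ?_ c₃
    · change (d : ℝ) / 2 < (d : ℝ) / 2 + 1
      linarith
    · exact ⟨show (d : ℝ) / 2 - 1 < (d : ℝ) / 2 + 1 by linarith,
        show (0 : ℝ) < 1 from one_pos⟩
    · exact ⟨show (d : ℝ) / 2 - 1 < (d : ℝ) / 2 - 1 / 2 by linarith,
        show (0 : ℝ) < 1 from one_pos⟩
    · exact ⟨show (d : ℝ) / 2 - 1 < (d : ℝ) / 2 - 1 / 2 by linarith,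
        show (d : ℝ) / 2 - 1 / 2 < (d : ℝ) / 2 by linarith⟩
  have hcoe : (d : ℂ) / 2 = (((d : ℝ) / 2 : ℝ) : ℂ) := by push_cast; rfl
  have hmem : ∀ w ∈ S₁ ∪ S₂ ∪ S₃, (d : ℝ) / 2 - 1 < w.re ∧ w ≠ (d : ℂ) / 2 := by
    rintro w ((hw | hw) | hw)
    · have hw' : (d : ℝ) / 2 < w.re := hw
      refine ⟨by linarith, fun h => ?_⟩
      rw [h, hcoe, Complex.ofReal_re] at hw'
      exact lt_irrefl _ hw'
    · refine ⟨hw.1, fun h => ?_⟩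
      have hw' : 0 < w.im := hw.2
      rw [h, hcoe, Complex.ofReal_im] at hw'
      exact lt_irrefl _ hw'
    · refine ⟨hw.1, fun h => ?_⟩
      have hw' : w.re < (d : ℝ) / 2 := hw.2
      rw [h, hcoe, Complex.ofReal_re] at hw'
      exact lt_irrefl _ hw'
  have hT : DifferentiableOn ℂ (fun s => ∑' n, cellDefect A n s) (S₁ ∪ S₂ ∪ S₃) := fun w hw =>
    (summable_and_differentiableAt_tsum (k := 2) (differentiable_cellDefect hA) cellDefect_zero
      (fun M hM => exists_cellDefect_bound hA hM)
      (by linarith [(hmem w hw).1])).2.differentiableWithinAt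
  have hR : DifferentiableOn ℂ (fun s => Z s + centralIntegral A s) (S₁ ∪ S₂ ∪ S₃) := fun w hw =>
    ((hZ.differentiableOn.differentiableAt (isOpen_compl_singleton.mem_nhds (hmem w hw).2)).add
      (differentiableAt_centralIntegral hA (hmem w hw).2)).differentiableWithinAt
  have hz₀ : (⟨(d : ℝ) / 2 + 1, 0⟩ : ℂ) ∈ S₁ := show (d : ℝ) / 2 < (d : ℝ) / 2 + 1 by linarith
  refine (hT.analyticOnNhd ho).eqOn_of_preconnected_of_eventuallyEq (hR.analyticOnNhd ho) hpre
    (Or.inl (Or.inl hz₀)) ?_ (Or.inr ⟨h1, h2⟩)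
  filter_upwards [(isOpen_lt continuous_const Complex.continuous_re).mem_nhds hz₀] with w hw
  exact tsum_cellDefect_of_gt hA hZ hw

/-- In the strip, the sum of the second order terms is explicit. -/
theorem tsum_cellDefect_eq_remainder (hA : A.PosDef) {s : ℂ} (h1 : (d : ℝ) / 2 - 1 < s.re) :
    ∑' n, cellDefect A n s = ∑' n, cellRemainder A n s +
      ((1 / 2 : ℝ) : ℂ) ^ ((d : ℂ) - 2 - 2 * s) / 24 *
        ((s - ((d : ℂ) / 2 - 1))⁻¹ * (s * V A s)) := by
  have hsum := (summable_and_differentiableAt_tsum (k := 2) (differentiable_cellDefect hA)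
    cellDefect_zero (fun M hM => exists_cellDefect_bound hA hM) (s := s) (by linarith)).1
  have hsum' := (summable_and_differentiableAt_tsum (k := 3) (differentiable_cellRemainder hA)
    cellRemainder_zero (fun M hM => exists_cellRemainder_bound hA hM) (s := s) (by linarith)).1
  have hre : ((d : ℂ) - 2 - 2 * s).re < 0 := by simp; linarith
  have hne : (d : ℂ) - 2 - 2 * s ≠ 0 := fun h => by rw [h] at hre; exact lt_irrefl _ hre
  refine tendsto_nhds_unique (tendsto_sum_puncturedBox hsum (cellDefect_zero s)) ?_
  simp only [cellDefect_sum_eq_remainder hA]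
  refine (tendsto_sum_puncturedBox hsum' (cellRemainder_zero s)).add ?_
  have hint : ∀ N : ℕ, (∫ r in (1 / 2 : ℝ)..((N : ℝ) + 1 / 2), (r : ℂ) ^ ((d : ℂ) - 3 - 2 * s)) =
      ((((N : ℝ) + 1 / 2 : ℝ) : ℂ) ^ ((d : ℂ) - 2 - 2 * s) -
        ((1 / 2 : ℝ) : ℂ) ^ ((d : ℂ) - 2 - 2 * s)) / ((d : ℂ) - 2 - 2 * s) := fun N => by
    rw [integral_cpow, show (d : ℂ) - 3 - 2 * s + 1 = d - 2 - 2 * s by ring]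
    refine Or.inr ⟨fun h => hne (by linear_combination h), fun h => ?_⟩
    rw [Set.uIcc_of_le (by linarith [Nat.cast_nonneg (α := ℝ) N])] at h
    norm_num at h
  simp only [hint]
  have hlim := (((tendsto_natCast_add_half_cpow hre).sub_const
    (((1 / 2 : ℝ) : ℂ) ^ ((d : ℂ) - 2 - 2 * s))).div_const
      ((d : ℂ) - 2 - 2 * s) |>.mul_const (V A s)).const_mul (s / 12)
  convert hlim using 2
  -- The outer power vanishes in the limit, and `-1 / (d - 2 - 2 s) = 1 / (2 (s - s₀))` turns `1/12`
  -- into `1/24`.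
  have e : s - ((d : ℂ) / 2 - 1) = -((d : ℂ) - 2 - 2 * s) / 2 := by ring
  rw [e]
  field_simp
  ring

/-! ### The critical point `d/2 - 1` -/

theorem tendsto_critical_segment (d : ℕ) :
    Tendsto (fun ε : ℝ => (d : ℂ) / 2 - 1 + (ε : ℂ)) (𝓝[>] 0) (𝓝[≠] ((d : ℂ) / 2 - 1)) := by
  refine tendsto_nhdsWithin_iff.2 ⟨?_, ?_⟩
  · have : Tendsto (fun ε : ℝ => (d : ℂ) / 2 - 1 + (ε : ℂ)) (𝓝 0)
        (𝓝 ((d : ℂ) / 2 - 1 + ((0 : ℝ) : ℂ))) :=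
      (continuous_const.add Complex.continuous_ofReal).tendsto 0
    rw [Complex.ofReal_zero, add_zero] at this
    exact this.mono_left nhdsWithin_le_nhds
  · filter_upwards [self_mem_nhdsWithin] with ε (hε : 0 < ε) h
    have h' : (d : ℂ) / 2 - 1 + (ε : ℂ) = (d : ℂ) / 2 - 1 := h
    have : (ε : ℂ) = 0 := by linear_combination h'
    exact hε.ne' (by exact_mod_cast this)

theorem critical_add_re (d : ℕ) (ε : ℝ) :
    ((d : ℂ) / 2 - 1 + (ε : ℂ)).re = (d : ℝ) / 2 - 1 + ε := by
  rw [show (d : ℂ) / 2 - 1 + (ε : ℂ) = (((d : ℝ) / 2 - 1 + ε : ℝ) : ℂ) by push_cast; rfl,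
    Complex.ofReal_re]

theorem critical_re (d : ℕ) : ((d : ℂ) / 2 - 1).re = (d : ℝ) / 2 - 1 := by
  simp

theorem critical_ne (d : ℕ) : (d : ℂ) / 2 - 1 ≠ (d : ℂ) / 2 := fun h => by
  have : (1 : ℂ) = 0 := by linear_combination -h
  exact one_ne_zero this

/-- At the critical point `s V(s)` vanishes, and its derivative measures the failure of the
remainder sum to represent the zeta function. -/
theorem critical_identity (hA : A.PosDef) {Z : ℂ → ℂ} (hZ : IsEpsteinZeta A Z) :
    ((d : ℂ) / 2 - 1) * V A ((d : ℂ) / 2 - 1) = 0 ∧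
    Z ((d : ℂ) / 2 - 1) + centralIntegral A ((d : ℂ) / 2 - 1) =
      ∑' n, cellRemainder A n ((d : ℂ) / 2 - 1) +
      (V A ((d : ℂ) / 2 - 1) + ((d : ℂ) / 2 - 1) * deriv (V A) ((d : ℂ) / 2 - 1)) / 24 := by
  set s₀ : ℂ := (d : ℂ) / 2 - 1 with hs₀
  have hseg := tendsto_critical_segment d
  rw [← hs₀] at hseg
  have hseg' := tendsto_nhdsWithin_iff.1 hseg |>.1
  have hU : ContinuousAt (fun s => ∑' n, cellRemainder A n s) s₀ :=
    (summable_and_differentiableAt_tsum (k := 3) (differentiable_cellRemainder hA)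
      cellRemainder_zero (fun M hM => exists_cellRemainder_bound hA hM) (s := s₀)
      (by rw [hs₀, critical_re]; linarith)).2.continuousAt
  have hZc : ContinuousAt Z s₀ := (hZ.differentiableOn.differentiableAt
    (isOpen_compl_singleton.mem_nhds (critical_ne d))).continuousAt
  have hβ := (differentiableAt_centralIntegral hA (critical_ne d)).continuousAt
  have hP : ContinuousAt (fun s : ℂ => ((1 / 2 : ℝ) : ℂ) ^ ((d : ℂ) - 2 - 2 * s) / 24) s₀ := by
    have h1 : DifferentiableAt ℂ (fun s : ℂ => (d : ℂ) - 2 - 2 * s) s₀ := by fun_prop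
    exact ((h1.const_cpow (Or.inl (by norm_num))).div_const 24).continuousAt
  have hP0 : ((1 / 2 : ℝ) : ℂ) ^ ((d : ℂ) - 2 - 2 * s₀) / 24 = 1 / 24 := by
    rw [show (d : ℂ) - 2 - 2 * s₀ = 0 by rw [hs₀]; ring, Complex.cpow_zero]
  have hV : HasDerivAt (fun s => s * V A s) (V A s₀ + s₀ * deriv (V A) s₀) s₀ := by
    exact ((hasDerivAt_id s₀).mul (differentiable_V hA s₀).hasDerivAt).congr_deriv (by simp)
  have hev : ∀ᶠ ε : ℝ in 𝓝[>] 0, Z (s₀ + ε) + centralIntegral A (s₀ + ε) =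
      ∑' n, cellRemainder A n (s₀ + ε) +
      ((1 / 2 : ℝ) : ℂ) ^ ((d : ℂ) - 2 - 2 * (s₀ + ε)) / 24 *
        (((s₀ + ε) - s₀)⁻¹ * ((s₀ + ε) * V A (s₀ + ε))) := by
    filter_upwards [Ioo_mem_nhdsGT (one_pos : (0 : ℝ) < 1)] with ε hε
    have h1 : (d : ℝ) / 2 - 1 < (s₀ + (ε : ℂ)).re := by
      rw [hs₀, critical_add_re]; linarith [hε.1]
    have h2 : (s₀ + (ε : ℂ)).re < (d : ℝ) / 2 := by
      rw [hs₀, critical_add_re]; linarith [hε.2]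
    rw [← tsum_cellDefect_of_strip hA hZ h1 h2, tsum_cellDefect_eq_remainder hA h1]
  have hL : Tendsto (fun ε : ℝ => Z (s₀ + ε) + centralIntegral A (s₀ + ε) -
      ∑' n, cellRemainder A n (s₀ + ε)) (𝓝[>] 0)
      (𝓝 (Z s₀ + centralIntegral A s₀ - ∑' n, cellRemainder A n s₀)) :=
    ((hZc.add hβ).sub hU).tendsto.comp hseg'
  have hPε := hP.tendsto.comp hseg'
  rw [hP0] at hPε
  -- Multiplied by `ε`, the side with `Z` tends to `0`, whereas the other tends to `s₀ V(s₀) / 24`.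
  have hzero : s₀ * V A s₀ = 0 := by
    have hl : Tendsto (fun ε : ℝ => ((s₀ + (ε : ℂ)) - s₀) * (Z (s₀ + ε) +
        centralIntegral A (s₀ + ε) - ∑' n, cellRemainder A n (s₀ + ε))) (𝓝[>] 0) (𝓝 0) := by
      have h1 := ((hseg'.sub_const s₀).mul hL)
      rwa [sub_self, zero_mul] at h1
    have hr : Tendsto (fun ε : ℝ => ((1 / 2 : ℝ) : ℂ) ^ ((d : ℂ) - 2 - 2 * (s₀ + ε)) / 24 *
        ((s₀ + ε) * V A (s₀ + ε))) (𝓝[>] 0) (𝓝 (1 / 24 * (s₀ * V A s₀))) :=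
      hPε.mul (hV.continuousAt.tendsto.comp hseg')
    have heq := tendsto_nhds_unique_of_eventuallyEq hl hr (by
      filter_upwards [hev, self_mem_nhdsWithin] with ε h (hε : 0 < ε)
      have hε' : (s₀ + (ε : ℂ)) - s₀ ≠ 0 := by
        rw [add_sub_cancel_left]; exact_mod_cast hε.ne'
      rw [h]
      linear_combination (((1 / 2 : ℝ) : ℂ) ^ ((d : ℂ) - 2 - 2 * (s₀ + ε)) / 24 *
        ((s₀ + ε) * V A (s₀ + ε))) * mul_inv_cancel₀ hε')
    linear_combination -24 * heq
  refine ⟨hzero, ?_⟩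
  -- As `s V(s)` vanishes at `s₀`, the quotient is its difference quotient there.
  have hslope : Tendsto (fun ε : ℝ => ((s₀ + (ε : ℂ)) - s₀)⁻¹ * ((s₀ + ε) * V A (s₀ + ε)))
      (𝓝[>] 0) (𝓝 (V A s₀ + s₀ * deriv (V A) s₀)) := by
    refine ((hasDerivAt_iff_tendsto_slope.1 hV).comp hseg).congr fun ε => ?_
    simp only [Function.comp_apply, slope_def_module, hzero, sub_zero, smul_eq_mul]
  have hr := tendsto_nhds_unique_of_eventuallyEq hL (hPε.mul hslope) (by
    filter_upwards [hev] with ε h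
    rw [h]
    exact add_sub_cancel_left _ _)
  linear_combination hr

/-- Needed when `d = 2`: then `s₀ = 0`, and `s₀ V(s₀) = 0` says nothing about `V(s₀)`. At `s = 0`
the integrand is `1`, so every defect vanishes and the central cell contributes its volume. -/
theorem sigmaN_zero (hd : 1 ≤ d) (hA : A.PosDef) (N : ℕ) : sigmaN A N 0 = -1 := by
  have hd0 : (0 : ℝ) < d := by exact_mod_cast hd
  have h0 : (0 : ℂ).re < (d : ℝ) / 2 := by rw [Complex.zero_re]; positivity
  have hq : ∀ x, qPow A 0 x = 1 := fun x => by simp [qPow]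
  have h1 : ∀ n, cellDefect A n 0 = 0 := fun n => by
    simp only [cellDefect, hq, setIntegral_const, volume_cell]
    simp
  rw [sigmaN_eq hd hA h0, Finset.sum_eq_zero fun n _ => h1 n, centralIntegral,
    ← integral_closedBall_qPow hd hA h0 (by norm_num)]
  simp only [hq, setIntegral_const, volume_unitCube]
  simp

end WignerLimit

end

/-! ### The main theorem -/

open WignerLimit

theorem theorem4p4 {d : ℕ} (hd : 1 ≤ d) (A : Matrix (Fin d) (Fin d) ℝ) (hA : A.PosDef) :
    (∀ (N : ℕ) (s : ℂ), s.re < (d : ℝ) / 2 →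
      IntegrableOn (fun x : Fin d → ℝ => 1 / ((WignerLimit.quadForm A x : ℝ) : ℂ) ^ s)
        (WignerLimit.cube d N)) ∧
    DifferentiableAt ℂ (WignerLimit.V A) ((d : ℂ) / 2 - 1) ∧
    ∃ α σ : ℂ → ℂ,
      WignerLimit.IsEpsteinZeta A α ∧
      (∀ s : ℂ, (d : ℝ) / 2 - 1 < s.re → s.re < (d : ℝ) / 2 →
        Tendsto (fun N : ℕ => WignerLimit.sigmaN A N s) atTop (𝓝 (σ s))) ∧
      Tendsto (fun N : ℕ => WignerLimit.sigmaN A N ((d : ℂ) / 2 - 1)) atTop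
        (𝓝 (σ ((d : ℂ) / 2 - 1))) ∧
      (∀ s : ℂ, (d : ℝ) / 2 - 1 < s.re → s.re < (d : ℝ) / 2 → σ s = α s) ∧
      σ ((d : ℂ) / 2 - 1) +
          ((d : ℂ) / 2 - 1) / 24 * deriv (WignerLimit.V A) ((d : ℂ) / 2 - 1) =
        α ((d : ℂ) / 2 - 1) ∧
      Tendsto (fun ε : ℝ => σ ((d : ℂ) / 2 - 1 + (ε : ℂ))) (𝓝[>] 0)
        (𝓝 (α ((d : ℂ) / 2 - 1))) := by
  refine ⟨fun N s hs => ?_, differentiable_V hA _, ?_⟩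
  · rw [cube_eq_closedBall]
    exact (locallyIntegrable_qPow hd hA hs).integrableOn_isCompact (isCompact_closedBall _ _)
  obtain ⟨Z, hZ, hZ0⟩ := exists_isEpsteinZeta hd hA
  obtain ⟨hc1, hc2⟩ := critical_identity hA hZ
  set s₀ : ℂ := (d : ℂ) / 2 - 1 with hs₀
  have hre₀ : s₀.re = (d : ℝ) / 2 - 1 := critical_re d
  -- At `s₀` the limit is the remainder sum minus the central term. The values outside the strip and
  -- `s₀` play no role.
  let σ : ℂ → ℂ := fun s =>
    if s = s₀ then ∑' n, cellRemainder A n s₀ - centralIntegral A s₀ else Z s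
  have hσ₀ : σ s₀ = ∑' n, cellRemainder A n s₀ - centralIntegral A s₀ := if_pos rfl
  have hσ : ∀ s : ℂ, (d : ℝ) / 2 - 1 < s.re → σ s = Z s := fun s hs =>
    if_neg fun h => by rw [h, hre₀] at hs; exact lt_irrefl _ hs
  have hcrit : Tendsto (fun N : ℕ => sigmaN A N s₀) atTop (𝓝 (σ s₀)) := by
    have hsum := (summable_and_differentiableAt_tsum (k := 3) (differentiable_cellRemainder hA)
      cellRemainder_zero (fun M hM => exists_cellRemainder_bound hA hM) (s := s₀)
      (by rw [hre₀]; linarith)).1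
    rw [hσ₀]
    refine ((tendsto_sum_puncturedBox hsum (cellRemainder_zero s₀)).sub_const _).congr fun N => ?_
    rw [sigmaN_eq hd hA (by rw [hre₀]; linarith), cellDefect_sum_eq_remainder hA]
    -- The radial integral grows logarithmically in `N`, but its coefficient `s₀ V(s₀)` is zero.
    linear_combination -(1 / 12 : ℂ) *
      (∫ r in (1 / 2 : ℝ)..((N : ℝ) + 1 / 2), (r : ℂ) ^ ((d : ℂ) - 3 - 2 * s₀)) * hc1
  refine ⟨Z, σ, hZ, fun s h1 h2 => ?_, hcrit, fun s h1 _ => hσ s h1, ?_, ?_⟩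
  · have hsum := (summable_and_differentiableAt_tsum (k := 2) (differentiable_cellDefect hA)
      cellDefect_zero (fun M hM => exists_cellDefect_bound hA hM) (s := s) (by linarith)).1
    have h := (tendsto_sum_puncturedBox hsum (cellDefect_zero s)).sub_const (centralIntegral A s)
    rw [tsum_cellDefect_of_strip hA hZ h1 h2, add_sub_cancel_right] at h
    rw [hσ s h1]
    exact h.congr fun N => (sigmaN_eq hd hA h2 N).symm
  -- For `s₀ = 0` the derivative term drops out and both sides are `-1`. Otherwise `V(s₀) = 0`, and
  -- only `s₀ V'(s₀) / 24` remains in `hc2`.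
  · by_cases h0 : s₀ = 0
    · have h1 : σ s₀ = -1 := by
        refine tendsto_nhds_unique hcrit ?_
        simp only [h0, sigmaN_zero hd hA]
        exact tendsto_const_nhds
      rw [h1, h0, hZ0]; ring
    · have hV0 : V A s₀ = 0 := (mul_eq_zero.1 hc1).resolve_left h0
      rw [hV0] at hc2
      rw [hσ₀]
      linear_combination -hc2
  · have hZc : ContinuousAt Z s₀ := (hZ.differentiableOn.differentiableAt
      (isOpen_compl_singleton.mem_nhds (critical_ne d))).continuousAt
    refine (hZc.tendsto.comp (tendsto_nhdsWithin_iff.1 (tendsto_critical_segment d)).1).congr' ?_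
    filter_upwards [self_mem_nhdsWithin] with ε (hε : 0 < ε)
    refine (hσ _ ?_).symm
    change (d : ℝ) / 2 - 1 < ((d : ℂ) / 2 - 1 + (ε : ℂ)).re
    rw [critical_add_re]
    linarith
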